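/- Let $(M,\omega)$ and $(M_1,\omega_1)$ be smooth symplectic manifolds (Hausdorff, paracompact) of dimension $2n$, let $0\le l\le n$, and let $\sigma:M\to M_1$ be a symplectomorphism. For $x\in M$ let $\mathcal Z^l_{M,x}$ be the set of endomorphisms $j$ of $T_xM$ with $j^2=-\mathrm{Id}$, $\omega(jX,jY)=\omega(X,Y)$ and such that the symmetric form $\omega(\cdot,j\,\cdot)$ has signature $(2n-2l,2l)$; let $\pi:\mathcal Z^l_M=\bigcup_x\mathcal Z^l_{M,x}\to M$ be the resulting bundle, a submanifold of $\mathrm{End}(TM)$. A symplectic connection is a smooth torsion-free linear connection $\nabla$ on $TM$ with $\nabla\omega=0$. Such a $\nabla$ splits $T\mathcal Z^l_M=\mathcal H^\nabla\oplus\mathcal V$, where $\mathcal V=\ker d\pi$ and $\mathcal H^\nabla=\{u:(\pi^*\nabla)_u\Phi=0\}$, $\Phi$ being the tautological section $\Phi_j=j$ of $\mathrm{End}(\pi^*TM)$. The twistor almost complex structure $\mathcal J^\nabla$ preserves this splitting; at $j$ it is given on $\mathcal H^\nabla_j\cong T_{\pi(j)}M$ (via $d\pi$) by $j$, and on $\mathcal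 V_j\subset\mathrm{End}(T_{\pi(j)}M)$ by $A\mapsto jA$. Let $\mathcal Z^l_{M_1}$, $\mathcal J^{\nabla^2}$ be defined in the same way from $(M_1,\omega_1)$ and a symplectic connection $\nabla^2$ on $M_1$, and let $\Sigma:\mathcal Z^l_M\to\mathcal Z^l_{M_1}$, $\Sigma(j)=d\sigma\circ j\circ d\sigma^{-1}$. Let $\sigma\cdot\nabla$ be the connection on $M_1$ given by $(\sigma\cdot\nabla)_XY=\sigma\cdot\left(\nabla_{\sigma^{-1}\cdot X}(\sigma^{-1}\cdot Y)\right)$, where $\sigma\cdot Z$ denotes the push-forward of a vector field. Let $\nabla$ be a symplectic connection on $M$ and $\nabla^2$ a symplectic connection on $M_1$. If $\Sigma:(\mathcal Z^l_M,\mathcal J^\nabla)\to(\mathcal Z^l_{M_1},\mathcal J^{\nabla^2})$ is (pseudo-)holomorphic, i.e. $d\Sigma\circ\mathcal J^\nabla=\mathcal J^{\nabla^2}\circ d\Sigma$, then $$\nabla^2=\sigma\cdot\nabla .$$ In particular $\nabla^2$ lies in the affine transformation orbit $\{\tau\cdot\nabla:\ \tau:M\to M_1\text{ a symplectomorphism}\}$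 of $\nabla$. -/

import Mathlib

open Bundle Manifold VectorField
open scoped ContDiff Topology

set_option linter.unusedSectionVars false

noncomputable section

namespace SympTwistor

section Basic

variable (E : Type*) [NormedAddCommGroup E] [NormedSpace ℝ E]
  (M : Type*) [TopologicalSpace M] [ChartedSpace E M]

/-- The total space of the bundle `End(TM) → M`. Its points are pairs `⟨x, j⟩` with `x : M` and
`j` an endomorphism of `T_x M`. -/
abbrev EndT [IsManifold 𝓘(ℝ, E) 1 M] : Type _ :=
  TotalSpace (E →L[ℝ] E)
    (fun x : M ↦ TangentSpace 𝓘(ℝ, E) x →L[ℝ] TangentSpace 𝓘(ℝ, E) x)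

/-- The model with corners of the total space of `End(TM)`. -/
abbrev endModel : ModelWithCorners ℝ (E × (E →L[ℝ] E)) (ModelProd E (E →L[ℝ] E)) :=
  𝓘(ℝ, E).prod 𝓘(ℝ, E →L[ℝ] E)

/-- A linear connection on `M` (a covariant derivative on `TM`);
`D Y x (X x)` is `(D_X Y)(x)`. -/
abbrev LinConnection [IsManifold 𝓘(ℝ, E) 1 M] : Type _ :=
  CovariantDerivative 𝓘(ℝ, E) E (TangentSpace 𝓘(ℝ, E) : M → Type _)

/-- A symplectic form on `M`: a smooth, closed, non-degenerate `2`-form. -/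
structure SymplecticForm [IsManifold 𝓘(ℝ, E) ∞ M] where
  toFun : ∀ x : M, TangentSpace 𝓘(ℝ, E) x →L[ℝ] TangentSpace 𝓘(ℝ, E) x →L[ℝ] ℝ
  smooth : ContMDiff 𝓘(ℝ, E) (𝓘(ℝ, E).prod 𝓘(ℝ, E →L[ℝ] E →L[ℝ] ℝ)) ∞
    (fun x ↦ TotalSpace.mk' (E →L[ℝ] E →L[ℝ] ℝ)
      (E := fun x : M ↦ TangentSpace 𝓘(ℝ, E) x →L[ℝ] TangentSpace 𝓘(ℝ, E) x →L[ℝ] ℝ)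
      x (toFun x))
  alternating : ∀ x v, toFun x v v = 0
  nondegenerate : ∀ x v, (∀ w, toFun x v w = 0) → v = 0
  /-- `dω = 0`, evaluated on vector fields. -/
  closed : ∀ X Y Z : (∀ x : M, TangentSpace 𝓘(ℝ, E) x),
    CMDiff ∞ (T% X) → CMDiff ∞ (T% Y) → CMDiff ∞ (T% Z) → ∀ x,
      d% (fun y ↦ toFun y (Y y) (Z y)) x (X x)
      - d% (fun y ↦ toFun y (X y) (Z y)) x (Y x)
      + d% (fun y ↦ toFun y (X y) (Y y)) x (Z x)
      - toFun x (mlieBracket 𝓘(ℝ, E) X Y x) (Z x)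
      + toFun x (mlieBracket 𝓘(ℝ, E) X Z x) (Y x)
      - toFun x (mlieBracket 𝓘(ℝ, E) Y Z x) (X x) = 0

end Basic

section Twistor

variable {E : Type*} [NormedAddCommGroup E] [NormedSpace ℝ E] [FiniteDimensional ℝ E]
  {M : Type*} [TopologicalSpace M] [ChartedSpace E M] [IsManifold 𝓘(ℝ, E) ∞ M]

/-- Symplectic connections: smooth, torsion-free and `∇ω = 0`. -/
structure IsSymplecticConnection (Ω : SymplecticForm E M) (D : LinConnection E M) : Prop where
  smooth : CovariantDerivative.ContMDiffCovariantDerivative D ∞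
  torsion_free : D.torsion = 0
  parallel : ∀ X Y Z : (∀ x : M, TangentSpace 𝓘(ℝ, E) x),
    CMDiff ∞ (T% X) → CMDiff ∞ (T% Y) → CMDiff ∞ (T% Z) → ∀ x,
      d% (fun y ↦ Ω.toFun y (Y y) (Z y)) x (X x) =
        Ω.toFun x (D Y x (X x)) (Z x) + Ω.toFun x (Y x) (D Z x (X x))


/-- The quadratic form `X ↦ ω(X, jX)` on `T_x M`, where `x` is the base point of `j`. -/
def metricForm (Ω : SymplecticForm E M) (j : EndT E M) :
    QuadraticForm ℝ (TangentSpace 𝓘(ℝ, E) j.proj) :=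
  LinearMap.BilinMap.toQuadraticMap
    (LinearMap.mk₂ ℝ (fun X Y ↦ Ω.toFun j.proj X (j.snd Y))
      (by intros; simp) (by intros; simp) (by intros; simp) (by intros; simp))

/-- The twistor space `𝒵^l`, as a subset (an embedded submanifold) of the total space of `End(TM)`:
all complex structures `j` on tangent spaces of `M` for which `ω` is of type `(1,1)` and `ω(·, j·)`
has signature `(2n - 2l, 2l)`, where `2n = dim M`. -/
def TwistorSpace (Ω : SymplecticForm E M) (l : ℕ) : Set (EndT E M) :=
  {j | (∀ X, j.snd (j.snd X) = -X) ∧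
    (∀ X Y, Ω.toFun j.proj (j.snd X) (j.snd Y) = Ω.toFun j.proj X Y) ∧
    sigPos (metricForm Ω j) + 2 * l = Module.finrank ℝ E ∧
    sigNeg (metricForm Ω j) = 2 * l}

/-- The tangent bundle of the submanifold `𝒵^l` of `End(TM)`: the set of all velocity vectors at
time `0` of smooth curves of `End(TM)` that stay in `𝒵^l`. -/
def twistorTangent (Ω : SymplecticForm E M) (l : ℕ) :
    Set (TangentBundle (endModel E) (EndT E M)) :=
  {u | ∃ c : ℝ → EndT E M, ContMDiffAt 𝓘(ℝ, ℝ) (endModel E) ∞ c 0 ∧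
    (∀ᶠ t in 𝓝 0, c t ∈ TwistorSpace Ω l) ∧
    u = tangentMap 𝓘(ℝ, ℝ) (endModel E) c ⟨0, (1 : ℝ)⟩}

lemma D_extend_add (D : LinConnection E M) {x : M} (v w : TangentSpace 𝓘(ℝ, E) x) :
    D (FiberBundle.extend E (v + w)) x
      = D (FiberBundle.extend E v) x + D (FiberBundle.extend E w) x := by
  have hv := FiberBundle.mdifferentiableAt_extend 𝓘(ℝ, E) E v
  have hw := FiberBundle.mdifferentiableAt_extend 𝓘(ℝ, E) E w
  rw [← D.isCovariantDerivativeOnUniv.add hv hw]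
  refine D.isCovariantDerivativeOnUniv.congr_of_eventuallyEq
    (FiberBundle.mdifferentiableAt_extend 𝓘(ℝ, E) E _)
    (mdifferentiableAt_add_section hv hw) Filter.univ_mem ?_
  have hx := FiberBundle.mem_baseSet_trivializationAt' (F := E)
    (E := (TangentSpace 𝓘(ℝ, E) : M → Type _)) x
  filter_upwards [(trivializationAt E (TangentSpace 𝓘(ℝ, E)) x).open_baseSet.mem_nhds hx] with y hy
  have hl := (trivializationAt E (TangentSpace 𝓘(ℝ, E)) x).linear ℝ hx
  refine (congrArg ((trivializationAt E (TangentSpace 𝓘(ℝ, E)) x).symm y) (hl.map_add v w)).trans ?_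
  have h := ((trivializationAt E (TangentSpace 𝓘(ℝ, E)) x).symmₗ ℝ y).map_add
    (trivializationAt E (TangentSpace 𝓘(ℝ, E)) x ⟨x, v⟩).2
    (trivializationAt E (TangentSpace 𝓘(ℝ, E)) x ⟨x, w⟩).2
  rw [Trivialization.coe_symmₗ _ hy] at h
  exact h

lemma D_extend_smul (D : LinConnection E M) {x : M} (a : ℝ) (v : TangentSpace 𝓘(ℝ, E) x) :
    D (FiberBundle.extend E (a • v)) x = a • D (FiberBundle.extend E v) x := by
  have hv := FiberBundle.mdifferentiableAt_extend 𝓘(ℝ, E) E v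
  rw [← D.isCovariantDerivativeOnUniv.smul_const a hv]
  refine D.isCovariantDerivativeOnUniv.congr_of_eventuallyEq
    (FiberBundle.mdifferentiableAt_extend 𝓘(ℝ, E) E _)
    (mdifferentiableAt_const.smul_section hv) Filter.univ_mem ?_
  have hx := FiberBundle.mem_baseSet_trivializationAt' (F := E)
    (E := (TangentSpace 𝓘(ℝ, E) : M → Type _)) x
  filter_upwards [(trivializationAt E (TangentSpace 𝓘(ℝ, E)) x).open_baseSet.mem_nhds hx] with y hy
  have hl := (trivializationAt E (TangentSpace 𝓘(ℝ, E)) x).linear ℝ hx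
  refine (congrArg ((trivializationAt E (TangentSpace 𝓘(ℝ, E)) x).symm y) (hl.map_smul a v)).trans ?_
  have h := ((trivializationAt E (TangentSpace 𝓘(ℝ, E)) x).symmₗ ℝ y).map_smul a
    (trivializationAt E (TangentSpace 𝓘(ℝ, E)) x ⟨x, v⟩).2
  rw [Trivialization.coe_symmₗ _ hy] at h
  exact h

/-- The Christoffel symbol: the endomorphism `v ↦ D_X V` of `T_x M`, where `V` is the extension of
`v` which is constant in the preferred local trivialization of `TM` at `x`. -/
def christoffel (D : LinConnection E M) (x : M) (X : TangentSpace 𝓘(ℝ, E) x) :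
    TangentSpace 𝓘(ℝ, E) x →L[ℝ] TangentSpace 𝓘(ℝ, E) x :=
  haveI : FiniteDimensional ℝ (TangentSpace 𝓘(ℝ, E) x) := inferInstanceAs (FiniteDimensional ℝ E)
  haveI : T2Space (TangentSpace 𝓘(ℝ, E) x) := inferInstanceAs (T2Space E)
  LinearMap.toContinuousLinearMap
    { toFun := fun v ↦ D (FiberBundle.extend E v) x X
      map_add' := fun v w ↦ by rw [D_extend_add]; rfl
      map_smul' := fun a v ↦ by rw [D_extend_smul]; rfl }

/-- The `D`-horizontal lift to `T_j End(TM)` of a tangent vector `X` at the base point of `j`, for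
the connection induced by `D` on `End(TM)`. A tangent vector to `End(TM)` at `j` is a pair in
`E × End(E)`, read in the preferred chart of `M` and in the trivialization of `TM` at the base
point. A section of `End(TM)` with local matrix `S` and value `j` at the base point has covariant
derivative `dS(X) + [Γ(X), j]`, so that the horizontal lift of `X` is `(X, -[Γ(X), j])`. -/
def horLift (D : LinConnection E M) (j : EndT E M) (X : TangentSpace 𝓘(ℝ, E) j.proj) :
    TangentSpace (endModel E) j :=
  ((X, j.snd ∘L christoffel D j.proj X - christoffel D j.proj X ∘L j.snd) : E × (E →L[ℝ] E))

/-- The vertical tangent vector to `End(TM)` at `j` given by `A ∈ End(T_x M)`; it is the velocity at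
`t = 0` of the curve `t ↦ j + tA`, see `vertLift_eq`. -/
def vertLift (j : EndT E M)
    (A : TangentSpace 𝓘(ℝ, E) j.proj →L[ℝ] TangentSpace 𝓘(ℝ, E) j.proj) :
    TangentSpace (endModel E) j :=
  ((0, A) : E × (E →L[ℝ] E))

/-- The projection `dπ(u)` of a tangent vector `u` to `End(TM)`. -/
def baseDir {j : EndT E M} (u : TangentSpace (endModel E) j) : TangentSpace 𝓘(ℝ, E) j.proj :=
  mfderiv (endModel E) 𝓘(ℝ, E) (TotalSpace.proj : EndT E M → M) j u

lemma baseDir_eq {j : EndT E M} (u : TangentSpace (endModel E) j) :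
    baseDir u = (show E × (E →L[ℝ] E) from u).1 := by
  have h : HasMFDerivAt (endModel E) 𝓘(ℝ, E) (TotalSpace.proj : EndT E M → M) j
      (ContinuousLinearMap.fst ℝ E (E →L[ℝ] E)) := by
    refine ⟨((contMDiff_proj (n := 1) (IB := 𝓘(ℝ, E)) _).continuous).continuousAt, ?_⟩
    have h0 : HasFDerivWithinAt (Prod.fst : E × (E →L[ℝ] E) → E)
      (ContinuousLinearMap.fst ℝ E (E →L[ℝ] E)) (Set.range (endModel E))
      (extChartAt (endModel E) j j) := hasFDerivWithinAt_fst
    refine h0.congr_of_eventuallyEq ?_ ?_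
    · filter_upwards [extChartAt_target_mem_nhdsWithin (I := endModel E) j] with z hz
      have hz' := hz
      rw [FiberBundle.extChartAt_target] at hz'
      have h1 : ((extChartAt (endModel E) j).symm z).proj = (extChartAt 𝓘(ℝ, E) j.proj).symm z.1 := by
        simp only [mfld_simps] at hz ⊢
        exact FiberBundle.chartedSpace_chartAt_symm_fst j z hz
      simp only [writtenInExtChartAt, Function.comp_apply]
      rw [h1]
      exact (extChartAt 𝓘(ℝ, E) j.proj).right_inv hz'.1.1
    · simp only [writtenInExtChartAt, Function.comp_apply, extChartAt_to_inv]
      rw [FiberBundle.extChartAt]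
      simp
  rw [baseDir, h.mfderiv]
  rfl

lemma inCoord_self (x : M) (A : TangentSpace 𝓘(ℝ, E) x →L[ℝ] TangentSpace 𝓘(ℝ, E) x) :
    ContinuousLinearMap.inCoordinates E (TangentSpace 𝓘(ℝ, E)) E (TangentSpace 𝓘(ℝ, E)) x x x x A
      = A := by
  rw [ContinuousLinearMap.inCoordinates, TangentBundle.continuousLinearMapAt_trivializationAt_eq_core
     (mem_chart_source E x), TangentBundle.symmL_trivializationAt_eq_core
     (mem_chart_source E x)]
  have h (v) := (tangentBundleCore 𝓘(ℝ, E) M).coordChange_self (achart E x) x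
    (mem_chart_source E x) v
  refine ContinuousLinearMap.ext fun v ↦ ?_
  exact (h _).trans (congrArg A (h v))

lemma vertLift_eq (j : EndT E M)
    (A : TangentSpace 𝓘(ℝ, E) j.proj →L[ℝ] TangentSpace 𝓘(ℝ, E) j.proj) :
    mfderiv 𝓘(ℝ, ℝ) (endModel E) (fun t : ℝ ↦ (⟨j.proj, j.snd + t • A⟩ : EndT E M)) 0 (1 : ℝ)
      = (show E × (E →L[ℝ] E) from vertLift j A) := by
  set c : ℝ → EndT E M := fun t ↦ ⟨j.proj, j.snd + t • A⟩ with hc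
  have hw : ∀ t, extChartAt (endModel E) (c 0) (c t)
      = (extChartAt 𝓘(ℝ, E) j.proj j.proj, (show E →L[ℝ] E from j.snd + t • A)) := by
    intro t
    rw [FiberBundle.extChartAt]
    simp only [hc, mfld_simps, hom_trivializationAt_apply]
    rw [inCoord_self]
  have hcont : ContinuousAt c 0 := by
    rw [continuousAt_hom_bundle]
    refine ⟨continuousAt_const, ?_⟩
    have h : (fun t ↦ ContinuousLinearMap.inCoordinates E (TangentSpace 𝓘(ℝ, E)) E
        (TangentSpace 𝓘(ℝ, E)) (c 0).1 (c t).1 (c 0).1 (c t).1 (c t).2)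
        = fun t : ℝ ↦ (show E →L[ℝ] E from j.snd) + t • (show E →L[ℝ] E from A) := by
      funext t
      exact inCoord_self j.proj (j.snd + t • A)
    rw [h]
    fun_prop
  have h : HasMFDerivAt 𝓘(ℝ, ℝ) (endModel E) c 0
      (ContinuousLinearMap.toSpanSingleton ℝ (show E × (E →L[ℝ] E) from vertLift j A)) := by
    refine ⟨hcont, HasFDerivAt.hasFDerivWithinAt ?_⟩
    have h1 : writtenInExtChartAt 𝓘(ℝ, ℝ) (endModel E) 0 c = fun t : ℝ ↦
        ((extChartAt 𝓘(ℝ, E) j.proj j.proj,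
          (show E →L[ℝ] E from j.snd) + t • (show E →L[ℝ] E from A)) : E × (E →L[ℝ] E)) := by
      funext t
      exact hw t
    have h2 : HasDerivAt (fun t : ℝ ↦
        ((extChartAt 𝓘(ℝ, E) j.proj j.proj,
          (show E →L[ℝ] E from j.snd) + t • (show E →L[ℝ] E from A)) : E × (E →L[ℝ] E)))
        (show E × (E →L[ℝ] E) from vertLift j A) 0 := by
      have aux : ∀ a b : E →L[ℝ] E, HasDerivAt (fun t : ℝ ↦ a + t • b) b 0 := fun a b ↦ by
        simpa using ((hasDerivAt_id (0 : ℝ)).smul_const b).const_add a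
      exact (hasDerivAt_const _ _).prodMk (aux _ _)
    rw [h1]
    exact h2.hasFDerivAt
  rw [h.mfderiv]
  exact one_smul ℝ _

/-- The covariant derivative `(π^*D)_u Φ` of the tautological section `Φ` of `End(π^*TM)`,
`Φ_j = j`: the vertical component of `u` along the `D`-horizontal distribution
`{u | (π^*D)_u Φ = 0}`, see `eq_horLift_add_vertLift`. -/
def nablaPhi (D : LinConnection E M) {j : EndT E M} (u : TangentSpace (endModel E) j) :
    TangentSpace 𝓘(ℝ, E) j.proj →L[ℝ] TangentSpace 𝓘(ℝ, E) j.proj :=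
  (show E × (E →L[ℝ] E) from u - horLift D j (baseDir u)).2

lemma eq_horLift_add_vertLift (D : LinConnection E M) {j : EndT E M}
    (u : TangentSpace (endModel E) j) :
    u = horLift D j (baseDir u) + vertLift j (nablaPhi D u) := by
  have h := baseDir_eq u
  have h1 : (show E × (E →L[ℝ] E) from u).1 = (show E from baseDir u) + (0 : E) :=
    h.symm.trans (add_zero (show E from baseDir u)).symm
  have h2 : (show E × (E →L[ℝ] E) from u).2
      = (show E × (E →L[ℝ] E) from horLift D j (baseDir u)).2
        + (show E × (E →L[ℝ] E) from u - horLift D j (baseDir u)).2 :=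
    (add_sub_cancel _ _).symm
  exact Prod.ext h1 h2

/-- The twistor almost complex structure `𝒥^D`, which preserves the splitting into `D`-horizontal and
vertical vectors: on the horizontal space at `j`, identified with `T_x M` by `dπ`, it is `j` itself;
on vertical vectors it is left multiplication by `j`. (The formula is used on vectors tangent to
`𝒵^l`; it makes sense on all of `T End(TM)`.) -/
def twistorJ (D : LinConnection E M) (u : TangentBundle (endModel E) (EndT E M)) :
    TangentBundle (endModel E) (EndT E M) :=
  ⟨u.proj, horLift D u.proj (u.proj.snd (baseDir u.snd))
    + vertLift u.proj (u.proj.snd ∘L nablaPhi D u.snd)⟩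

variable {M₁ : Type*} [TopologicalSpace M₁] [ChartedSpace E M₁] [IsManifold 𝓘(ℝ, E) ∞ M₁]

/-- The differential of a diffeomorphism, as an isomorphism of tangent spaces. -/
abbrev dEquiv (σ : M ≃ₘ^∞⟮𝓘(ℝ, E), 𝓘(ℝ, E)⟯ M₁) (x : M) :
    TangentSpace 𝓘(ℝ, E) x ≃L[ℝ] TangentSpace 𝓘(ℝ, E) (σ x) :=
  σ.mfderivToContinuousLinearEquiv (by simp) x

/-- `σ^*ω₁ = ω`. -/
def IsSymplectomorphism (Ω : SymplecticForm E M) (Ω₁ : SymplecticForm E M₁)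
    (σ : M ≃ₘ^∞⟮𝓘(ℝ, E), 𝓘(ℝ, E)⟯ M₁) : Prop :=
  ∀ x v w, Ω₁.toFun (σ x) (dEquiv σ x v) (dEquiv σ x w) = Ω.toFun x v w

/-- The map `Σ(j) = dσ ∘ j ∘ dσ⁻¹` induced by a diffeomorphism `σ`; it covers `σ` and, when `σ` is a
symplectomorphism, maps `𝒵^l_M` to `𝒵^l_{M₁}`, see `twistorMap_mem`. -/
def twistorMap (σ : M ≃ₘ^∞⟮𝓘(ℝ, E), 𝓘(ℝ, E)⟯ M₁) (j : EndT E M) : EndT E M₁ :=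
  ⟨σ j.proj, (dEquiv σ j.proj : _ →L[ℝ] _) ∘L j.snd ∘L ((dEquiv σ j.proj).symm : _ →L[ℝ] _)⟩

lemma metricForm_twistorMap {Ω : SymplecticForm E M} {Ω₁ : SymplecticForm E M₁}
    {σ : M ≃ₘ^∞⟮𝓘(ℝ, E), 𝓘(ℝ, E)⟯ M₁} (hσ : IsSymplectomorphism Ω Ω₁ σ) (j : EndT E M) :
    (metricForm Ω j).Equivalent (metricForm Ω₁ (twistorMap σ j)) :=
  ⟨{ (dEquiv σ j.proj).toLinearEquiv with
      map_app' := fun X ↦ by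
        have h : (dEquiv σ j.proj).symm (dEquiv σ j.proj X) = X :=
          (dEquiv σ j.proj).symm_apply_apply X
        change Ω₁.toFun (σ j.proj) (dEquiv σ j.proj X)
          (dEquiv σ j.proj (j.snd ((dEquiv σ j.proj).symm (dEquiv σ j.proj X)))) = _
        rw [h]
        exact hσ j.proj X (j.snd X) }⟩

theorem twistorMap_mem {Ω : SymplecticForm E M} {Ω₁ : SymplecticForm E M₁} {l : ℕ}
    {σ : M ≃ₘ^∞⟮𝓘(ℝ, E), 𝓘(ℝ, E)⟯ M₁} (hσ : IsSymplectomorphism Ω Ω₁ σ) {j : EndT E M}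
    (hj : j ∈ TwistorSpace Ω l) : twistorMap σ j ∈ TwistorSpace Ω₁ l := by
  obtain ⟨h1, h2, h3, h4⟩ := hj
  have he := metricForm_twistorMap hσ j
  refine ⟨fun (X : TangentSpace 𝓘(ℝ, E) (σ j.proj)) ↦ ?_,
    fun (X Y : TangentSpace 𝓘(ℝ, E) (σ j.proj)) ↦ ?_, he.sigPos_eq ▸ h3, he.sigNeg_eq ▸ h4⟩
  · change dEquiv σ j.proj (j.snd ((dEquiv σ j.proj).symm
      (dEquiv σ j.proj (j.snd ((dEquiv σ j.proj).symm X))))) = -X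
    rw [ContinuousLinearEquiv.symm_apply_apply, h1, map_neg,
      ContinuousLinearEquiv.apply_symm_apply]
  · change Ω₁.toFun (σ j.proj) (dEquiv σ j.proj (j.snd ((dEquiv σ j.proj).symm X)))
      (dEquiv σ j.proj (j.snd ((dEquiv σ j.proj).symm Y))) = Ω₁.toFun (σ j.proj) X Y
    rw [hσ, h2, ← hσ, ContinuousLinearEquiv.apply_symm_apply,
      ContinuousLinearEquiv.apply_symm_apply]

lemma dEquiv_symm_mpullback (σ : M ≃ₘ^∞⟮𝓘(ℝ, E), 𝓘(ℝ, E)⟯ M₁)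
    (Y : ∀ y : M₁, TangentSpace 𝓘(ℝ, E) y) (y : M₁) :
    (dEquiv σ.symm y).symm (mpullback 𝓘(ℝ, E) 𝓘(ℝ, E) σ Y (σ.symm y)) = Y y := by
  have h0 : mpullback 𝓘(ℝ, E) 𝓘(ℝ, E) σ Y (σ.symm y)
      = (dEquiv σ (σ.symm y)).symm (Y (σ (σ.symm y))) := by
    rw [mpullback_apply, ← Diffeomorph.mfderivToContinuousLinearEquiv_coe σ (by simp),
      ContinuousLinearMap.inverse_equiv]
    rfl
  rw [h0, ContinuousLinearEquiv.symm_apply_eq, ContinuousLinearEquiv.symm_apply_eq]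
  have hc := mfderiv_comp (I := 𝓘(ℝ, E)) (I' := 𝓘(ℝ, E)) (I'' := 𝓘(ℝ, E)) y
    (σ.mdifferentiable (by simp) (σ.symm y)) (σ.symm.mdifferentiable (by simp) y)
  have hid : (σ ∘ σ.symm : M₁ → M₁) = id := by funext z; simp
  rw [hid, mfderiv_id] at hc
  have h1 : (Y (σ (σ.symm y)) : E) = (Y y : E) := by
    exact congrArg (fun z ↦ (Y z : E)) (σ.apply_symm_apply y)
  refine h1.trans ?_
  exact congr($hc (Y y))

/-- The connection `σ·D` on `M₁`: `(σ·D)_X Y = σ·(D_{σ⁻¹·X} (σ⁻¹·Y))`. -/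
def pushConnection (σ : M ≃ₘ^∞⟮𝓘(ℝ, E), 𝓘(ℝ, E)⟯ M₁) (D : LinConnection E M) :
    LinConnection E M₁ where
  toFun Y y := ((dEquiv σ.symm y).symm : _ →L[ℝ] _) ∘L
    D (mpullback 𝓘(ℝ, E) 𝓘(ℝ, E) σ Y) (σ.symm y) ∘L (dEquiv σ.symm y : _ →L[ℝ] _)
  isCovariantDerivativeOnUniv := by
    have key : ∀ {Y : ∀ y : M₁, TangentSpace 𝓘(ℝ, E) y} {y : M₁}, MDiffAt (T% Y) y →
        MDiffAt (T% (mpullback 𝓘(ℝ, E) 𝓘(ℝ, E) σ Y)) (σ.symm y) := by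
      intro Y y hY
      refine MDifferentiableAt.mpullback_vectorField (n := ∞) ?_ (σ.contMDiff _) ?_
        (WithTop.coe_le_coe.2 (le_top : (2 : ℕ∞) ≤ ⊤))
      · rwa [σ.apply_symm_apply]
      · exact ⟨dEquiv σ (σ.symm y), rfl⟩
    refine ⟨fun {Y Y'} y hY hY' _ ↦ ?_, fun {Y g} y hY hg _ ↦ ?_⟩
    · rw [mpullback_add, D.isCovariantDerivativeOnUniv.add (key hY) (key hY')]
      ext v
      simp
    · have hgσ' : MDiffAt (g ∘ σ) (σ.symm y) := by
        refine MDifferentiableAt.comp (σ.symm y) ?_ (σ.mdifferentiable (by simp) _)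
        rwa [σ.apply_symm_apply]
      have hgσ : d% (g ∘ σ) (σ.symm y) ∘L (dEquiv σ.symm y : _ →L[ℝ] _) = d% g y := by
        have h : (g ∘ σ) ∘ σ.symm = g := by funext z; simp
        conv_rhs => rw [← h]
        exact (mvfderiv_comp y hgσ' (σ.symm.mdifferentiable (by simp) _)).symm
      rw [mpullback_smul, D.isCovariantDerivativeOnUniv.leibniz (key hY) hgσ']
      ext v
      have h1 : (g ∘ σ) (σ.symm y) = g y := by simp
      have h2 : d% (g ∘ σ) (σ.symm y) (dEquiv σ.symm y v) = d% g y v := congr($hgσ v)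
      simp only [ContinuousLinearMap.comp_apply, add_apply,
        smul_apply, ContinuousLinearMap.smulRight_apply,
        ContinuousLinearEquiv.coe_coe, map_add, map_smul, h1, h2, dEquiv_symm_mpullback]

/-- `Σ : (𝒵^l_M, 𝒥^D) → (𝒵^l_{M₁}, 𝒥^{D₁})` is (pseudo-)holomorphic: `dΣ ∘ 𝒥^D = 𝒥^{D₁} ∘ dΣ` on
the tangent bundle of `𝒵^l_M`. (`Σ` is always smooth, being the restriction of a smooth map
`End(TM) → End(TM₁)`.) -/
def IsHolomorphicTwistorMap (σ : M ≃ₘ^∞⟮𝓘(ℝ, E), 𝓘(ℝ, E)⟯ M₁) (Ω : SymplecticForm E M) (l : ℕ)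
    (D : LinConnection E M) (D₁ : LinConnection E M₁) : Prop :=
  ∀ u ∈ twistorTangent Ω l,
    tangentMap (endModel E) (endModel E) (twistorMap σ) (twistorJ D u) =
      twistorJ D₁ (tangentMap (endModel E) (endModel E) (twistorMap σ) u)

/-- Two linear connections are the same: `D_X Y = D'_X Y` at every point, for all vectors `X` at that
point and all vector fields `Y` differentiable there. (The values of a covariant derivative on
non-differentiable fields are meaningless.) -/
def SameConnection (D D' : LinConnection E M) : Prop :=
  ∀ (Y : ∀ x : M, TangentSpace 𝓘(ℝ, E) x) (x : M), MDiffAt (T% Y) x → D Y x = D' Y x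

/-- `D₁` belongs to the orbit `{τ·D}` of `D`, `τ` running over the symplectomorphisms. -/
def InAffineOrbit (Ω : SymplecticForm E M) (Ω₁ : SymplecticForm E M₁)
    (D : LinConnection E M) (D₁ : LinConnection E M₁) : Prop :=
  ∃ τ : M ≃ₘ^∞⟮𝓘(ℝ, E), 𝓘(ℝ, E)⟯ M₁,
    IsSymplectomorphism Ω Ω₁ τ ∧ SameConnection D₁ (pushConnection τ D)

end Twistor

end SympTwistor

end

/-! Let S be the difference of ∇² and σ·∇, a tensor on M₁. Both connections are torsion-free and
preserve ω₁, so T(X, Y, Z) = ω₁(S_X Y, Z) is a symmetric cubic form (`difference_symm`,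
`difference_skew`). The claim is T = 0.

Geometry: dΣ carries ∇-horizontal lifts to (σ·∇)-horizontal lifts and conjugates vertical vectors by
dσ (`mfderiv_twistorMap_horLift`, `mfderiv_twistorMap_vertLift`). Holomorphy of Σ therefore says
that the almost complex structures of ∇² and σ·∇ agree on vectors tangent to the twistor space. The
twistor projection is a submersion (`exists_mem_twistorTangent`), so every direction X is tested;
the vertical parts cancel, leaving [j, S_{jX}] = j[j, S_X] for every j in the fibre
(`IsHolomorphicTwistorMap.difference_identity`).

Algebra (`eq_zero_of_forall_isTwistor`): applying this identity to X and pairing with X gives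
T(X,X,X) = 3T(X,jX,jX). Conjugating j by the symplectic transvections that fix X replaces jX by jX +
aω(X,jX)X for any real a, and the coefficient of a² gives ω(X,jX)²T(X,X,X) = 0. So the cubic
vanishes wherever ω(X,jX) ≠ 0, hence everywhere by continuity, and T vanishes by polarization. The
continuity argument handles the null vectors of an indefinite form. -/

noncomputable section

namespace SympTwistor

/-! ### Symplectic bases -/

section LinearAlgebra

variable {V : Type*} [AddCommGroup V] [Module ℝ V]

/-- A symplectic family: `θ(eᵢ, fⱼ) = δᵢⱼ` and all other products vanish. -/
structure IsSymplecticFamily (θ : V →ₗ[ℝ] V →ₗ[ℝ] ℝ) {k : ℕ} (e f : Fin k → V) : Prop where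
  ee : ∀ i j, θ (e i) (e j) = 0
  ff : ∀ i j, θ (f i) (f j) = 0
  ef : ∀ i j, θ (e i) (f j) = if i = j then 1 else 0

variable {θ : V →ₗ[ℝ] V →ₗ[ℝ] ℝ}

/-- Symplectic Gram–Schmidt: a hyperbolic pair is added inside the orthogonal complement of the
previous ones. -/
lemma exists_isSymplecticFamily [FiniteDimensional ℝ V] (hθ : θ.IsAlt)
    (hnd : ∀ v, (∀ w, θ v w = 0) → v = 0) {n : ℕ} (hn : Module.finrank ℝ V = 2 * n) (k : ℕ)
    (hk : k ≤ n) : ∃ e f : Fin k → V, IsSymplecticFamily θ e f := by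
  induction k with
  | zero => exact ⟨Fin.elim0, Fin.elim0, ⟨fun i ↦ i.elim0, fun i ↦ i.elim0, fun i ↦ i.elim0⟩⟩
  | succ k ih =>
    obtain ⟨e, f, h⟩ := ih (by omega)
    -- The kernel of `L` is the orthogonal complement of the family; it is nonzero because 2k < 2n.
    let L : V →ₗ[ℝ] (Fin k → ℝ) × (Fin k → ℝ) :=
      (LinearMap.pi fun i ↦ θ (e i)).prod (LinearMap.pi fun i ↦ θ (f i))
    have hL : LinearMap.ker L ≠ ⊥ := by
      intro hbot
      have := LinearMap.finrank_le_finrank_of_injective (LinearMap.ker_eq_bot.1 hbot)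
      rw [hn] at this
      simp at this
      omega
    obtain ⟨w, hw, hw0⟩ := Submodule.exists_mem_ne_zero_of_ne_bot hL
    have hwe : ∀ i, θ (e i) w = 0 := fun i ↦ congrFun (congrArg Prod.fst hw) i
    have hwf : ∀ i, θ (f i) w = 0 := fun i ↦ congrFun (congrArg Prod.snd hw) i
    have neg : ∀ x y, θ x y = -θ y x := fun x y ↦ by rw [hθ.neg]
    have hwe' : ∀ i, θ w (e i) = 0 := fun i ↦ by rw [neg, hwe, neg_zero]
    have hwf' : ∀ i, θ w (f i) = 0 := fun i ↦ by rw [neg, hwf, neg_zero]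
    have : ∃ u, θ w u ≠ 0 := by
      by_contra! hc
      exact hw0 (hnd w hc)
    obtain ⟨u₀, hu₀⟩ := this
    obtain ⟨u, hu⟩ : ∃ u, θ w u = 1 := ⟨(θ w u₀)⁻¹ • u₀, by simp [hu₀]⟩
    -- Projection of `u` to the orthogonal complement of the family; the two signs differ because
    -- θ(fᵢ, eᵢ) = -1. The pairing with `w` is unchanged, as `w` is already orthogonal to the
    -- family.
    let u' := u + ∑ i, (θ (f i) u • e i - θ (e i) u • f i)
    have h1 : θ w u' = 1 := by simp [u', hu, hwe', hwf']
    have h2 : ∀ i, θ (e i) u' = 0 := fun i ↦ by simp [u', h.ee, h.ef]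
    have h3 : ∀ i, θ (f i) u' = 0 := fun i ↦ by
      have : ∀ x, θ (f i) (e x) = - if x = i then 1 else 0 := fun x ↦ by rw [neg, h.ef]
      simp [u', h.ff, this]
    have h2' : ∀ i, θ u' (e i) = 0 := fun i ↦ by rw [neg, h2, neg_zero]
    have h3' : ∀ i, θ u' (f i) = 0 := fun i ↦ by rw [neg, h3, neg_zero]
    refine ⟨Fin.cons w e, Fin.cons u' f, ⟨fun i j ↦ ?_, fun i j ↦ ?_, fun i j ↦ ?_⟩⟩
    · refine Fin.cases ?_ (fun i ↦ ?_) i <;> refine Fin.cases ?_ (fun j ↦ ?_) j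
      · simp [hθ.self_eq_zero]
      · simp [hwe']
      · simp [hwe]
      · simp [h.ee]
    · refine Fin.cases ?_ (fun i ↦ ?_) i <;> refine Fin.cases ?_ (fun j ↦ ?_) j
      · simp [hθ.self_eq_zero]
      · simp [h3']
      · simp [h3]
      · simp [h.ff]
    · refine Fin.cases ?_ (fun i ↦ ?_) i <;> refine Fin.cases ?_ (fun j ↦ ?_) j
      · simp [h1]
      · simp [hwf', (Fin.succ_ne_zero _).symm]
      · simp [h2]
      · simp [h.ef]

/-- Pairing a linear relation with `f i` isolates the coefficient of `e i`, and conversely. -/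
lemma IsSymplecticFamily.linearIndependent (hθ : θ.IsAlt) {k : ℕ} {e f : Fin k → V}
    (h : IsSymplecticFamily θ e f) : LinearIndependent ℝ (Sum.elim e f) := by
  rw [Fintype.linearIndependent_iff]
  intro g hg
  have fe : ∀ i j, θ (f i) (e j) = - if j = i then 1 else 0 := fun i j ↦ by
    rw [← hθ.neg, h.ef]
  rintro (i | i)
  · have := congrArg (θ (f i)) hg
    simpa [Fintype.sum_sum_type, h.ff, fe] using this
  · have := congrArg (θ (e i)) hg
    simpa [Fintype.sum_sum_type, h.ee, h.ef] using this

end LinearAlgebra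

/-! ### The fibre of the twistor space and the vanishing of the cubic form -/

section ComplexStructures

variable {V : Type*} [AddCommGroup V] [Module ℝ V] [TopologicalSpace V] [IsTopologicalAddGroup V]
  [ContinuousSMul ℝ V] {W : Type*} [AddCommGroup W] [Module ℝ W] [TopologicalSpace W]
  [IsTopologicalAddGroup W] [ContinuousSMul ℝ W]

/-- The quadratic form `X ↦ θ(X, jX)`. -/
def compatibleForm (θ : V →L[ℝ] V →L[ℝ] ℝ) (j : V →L[ℝ] V) : QuadraticForm ℝ V :=
  LinearMap.BilinMap.toQuadraticMap (LinearMap.mk₂ ℝ (fun X Y ↦ θ X (j Y))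
    (by intros; simp) (by intros; simp) (by intros; simp) (by intros; simp))

@[simp]
lemma compatibleForm_apply (θ : V →L[ℝ] V →L[ℝ] ℝ) (j : V →L[ℝ] V) (x : V) :
    compatibleForm θ j x = θ x (j x) := rfl

/-- `j` is a complex structure of type `(1,1)` for `θ`, and `θ(·, j·)` has signature
`(dim V - 2l, 2l)`. -/
structure IsTwistor (θ : V →L[ℝ] V →L[ℝ] ℝ) (l : ℕ) (j : V →L[ℝ] V) : Prop where
  sq : ∀ X, j (j X) = -X
  compat : ∀ X Y, θ (j X) (j Y) = θ X Y
  sigPos : sigPos (compatibleForm θ j) + 2 * l = Module.finrank ℝ V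
  sigNeg : sigNeg (compatibleForm θ j) = 2 * l

/-- Serves for transvections of one tangent space, for transport along dσ, and for passing to and
from a local trivialization. -/
lemma IsTwistor.conj {θ : V →L[ℝ] V →L[ℝ] ℝ} {θ' : W →L[ℝ] W →L[ℝ] ℝ} {l : ℕ} {j : V →L[ℝ] V}
    (h : IsTwistor θ l j) (g : V ≃L[ℝ] W) (hg : ∀ x y, θ' (g x) (g y) = θ x y) :
    IsTwistor θ' l ((g : V →L[ℝ] W) ∘L j ∘L (g.symm : W →L[ℝ] V)) := by
  have he : (compatibleForm θ j).Equivalent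
      (compatibleForm θ' ((g : V →L[ℝ] W) ∘L j ∘L (g.symm : W →L[ℝ] V))) :=
    ⟨{ g.toLinearEquiv with map_app' := fun X ↦ by simp [hg] }⟩
  refine ⟨fun X ↦ by simp [h.sq], fun X Y ↦ ?_, ?_, he.sigNeg_eq ▸ h.sigNeg⟩
  · have := hg (g.symm X) (g.symm Y)
    simp only [ContinuousLinearEquiv.apply_symm_apply] at this
    simp [hg, h.compat, this]
  · rw [← he.sigPos_eq, h.sigPos, g.toLinearEquiv.finrank_eq]

/-- In a symplectic basis, let j rotate each plane ⟨eᵢ, fᵢ⟩ by eᵢ ↦ sᵢfᵢ, fᵢ ↦ -sᵢeᵢ with sᵢ = ±1.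
Then θ(·, j·) is diagonal, with sᵢ occurring twice. -/
lemma exists_isTwistor [FiniteDimensional ℝ V] [T2Space V] {θ : V →L[ℝ] V →L[ℝ] ℝ}
    (halt : ∀ v, θ v v = 0) (hnd : ∀ v, (∀ w, θ v w = 0) → v = 0) {n l : ℕ}
    (hn : Module.finrank ℝ V = 2 * n) (hl : l ≤ n) : ∃ j, IsTwistor θ l j := by
  let θ' : V →ₗ[ℝ] V →ₗ[ℝ] ℝ := LinearMap.mk₂ ℝ (fun X Y ↦ θ X Y)
    (by intros; simp) (by intros; simp) (by intros; simp) (by intros; simp)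
  have hθ' : θ'.IsAlt := halt
  obtain ⟨e, f, h⟩ := exists_isSymplecticFamily (θ := θ') hθ' hnd hn n le_rfl
  let b : Module.Basis (Fin n ⊕ Fin n) ℝ V :=
    basisOfLinearIndependentOfCardEqFinrank' (Sum.elim e f) (h.linearIndependent hθ')
      (by simp [hn]; ring)
  have hbl : ∀ i, b (Sum.inl i) = e i := fun i ↦ by simp [b]
  have hbr : ∀ i, b (Sum.inr i) = f i := fun i ↦ by simp [b]
  -- Negative on exactly `l` planes, so the diagonal form has 2l negative squares.
  let s : Fin n → ℝ := fun i ↦ if (i : ℕ) < l then -1 else 1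
  have hs : ∀ i, s i * s i = 1 := fun i ↦ by simp only [s]; split_ifs <;> norm_num
  let J : V →ₗ[ℝ] V := b.constr ℝ (Sum.elim (fun i ↦ s i • f i) (fun i ↦ -(s i • e i)))
  have hJe : ∀ i, J (e i) = s i • f i := fun i ↦ by rw [← hbl, Module.Basis.constr_basis]; rfl
  have hJf : ∀ i, J (f i) = -(s i • e i) := fun i ↦ by rw [← hbr, Module.Basis.constr_basis]; rfl
  have fe : ∀ i j, θ (f i) (e j) = - if j = i then 1 else 0 := fun i j ↦ by
    have := hθ'.neg (e j) (f i)
    rw [h.ef] at this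
    exact this.symm
  have hee : ∀ i j, θ (e i) (e j) = 0 := h.ee
  have hff : ∀ i j, θ (f i) (f j) = 0 := h.ff
  have hef : ∀ i j, θ (e i) (f j) = if i = j then 1 else 0 := h.ef
  have hdec : ∀ x, x = ∑ i, (b.repr x (Sum.inl i) • e i) + ∑ i, (b.repr x (Sum.inr i) • f i) := by
    intro x
    refine (b.sum_repr x).symm.trans ?_
    rw [Fintype.sum_sum_type]
    simp only [hbl, hbr]
  let q : QuadraticForm ℝ V := compatibleForm θ (LinearMap.toContinuousLinearMap J)
  let w : Fin n ⊕ Fin n → ℝ := Sum.elim s s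
  have hq : q.Equivalent (QuadraticMap.weightedSumSquares ℝ w) := by
    refine ⟨{ b.equivFun with map_app' := fun x ↦ ?_ }⟩
    simp only [q, compatibleForm_apply, LinearMap.coe_toContinuousLinearMap',
      QuadraticMap.weightedSumSquares_apply]
    have hx := hdec x
    set p := fun i ↦ b.repr x (Sum.inl i)
    set r := fun i ↦ b.repr x (Sum.inr i)
    have hp : ∀ i, b.repr x (Sum.inl i) = p i := fun i ↦ rfl
    have hr : ∀ i, b.repr x (Sum.inr i) = r i := fun i ↦ rfl
    have hl : ∑ i, w i • (b.equivFun x i * b.equivFun x i)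
        = ∑ i, s i * (p i * p i) + ∑ i, s i * (r i * r i) := by
      simp [Fintype.sum_sum_type, w, hp, hr]
    refine hl.trans ?_
    rw [hx]
    simp only [map_add, map_sum, map_smul, hJe, hJf, add_apply, sum_apply,
      smul_apply, hee, hff, hef, fe, map_neg, smul_eq_mul, mul_ite, mul_neg, mul_zero, mul_one,
      Finset.sum_ite_eq, Finset.sum_ite_eq', Finset.mem_univ, if_true, Finset.sum_neg_distrib, Finset.sum_const_zero, add_zero, zero_add, neg_neg, hp, hr]
    congr 1 <;> exact Finset.sum_congr rfl fun i _ ↦ by ring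
  have hcard : Set.ncard {i | w i < 0} = 2 * l := by
    have hc : (Finset.univ.filter fun i : Fin n ↦ (i : ℕ) < l).card = l := by
      rw [Fin.card_filter_val_lt]
      omega
    have hw : ∀ i, s i < 0 ↔ (i : ℕ) < l := fun i ↦ by
      simp only [s]
      split_ifs with hi <;> simp [hi]
    rw [Set.ncard_eq_toFinset_card', Set.toFinset_ofPred, Finset.card_filter, Fintype.sum_sum_type]
    simp only [w, Sum.elim_inl, Sum.elim_inr, hw, ← Finset.card_filter, hc]
    ring
  have hcard' : Set.ncard {i | 0 < w i} + 2 * l = 2 * n := by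
    have hw : {i | 0 < w i} = {i | w i < 0}ᶜ := by
      ext i
      have : w i ≠ 0 := by
        rcases i with i | i <;> exact fun h0 ↦ by simpa [show s i = 0 from h0] using hs i
      simp only [Set.mem_ofPred_eq, Set.mem_compl_iff, not_lt]
      exact ⟨le_of_lt, fun h ↦ h.lt_of_ne this.symm⟩
    have := Set.ncard_add_ncard_compl {i | w i < 0}
    rw [← hw, hcard, Nat.card_eq_fintype_card, Fintype.card_sum, Fintype.card_fin] at this
    omega
  have hsq : J ∘ₗ J = -LinearMap.id := by
    refine b.ext fun i ↦ ?_
    rcases i with i | i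
    · simp [hbl, hJe, hJf, smul_smul, hs]
    · simp [hbr, hJe, hJf, smul_smul, hs]
  have hcomp : θ'.compl₁₂ J J = θ' := by
    refine LinearMap.ext_basis b b fun i k ↦ ?_
    change θ (J (b i)) (J (b k)) = θ (b i) (b k)
    rcases i with i | i <;> rcases k with k | k <;>
      by_cases hik : i = k <;>
      first
      | subst hik; simp [hbl, hbr, hJe, hJf, hee, hff, hef, fe, hs]
      | simp [hbl, hbr, hJe, hJf, hee, hff, hef, fe, hik, Ne.symm hik]
  refine ⟨LinearMap.toContinuousLinearMap J, LinearMap.congr_fun hsq, fun X Y ↦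
    LinearMap.congr_fun₂ hcomp X Y, ?_, ?_⟩
  · rw [QuadraticForm.sigPos_of_equiv_weightedSumSquares hq, hcard', hn]
  · rw [QuadraticForm.sigNeg_of_equiv_weightedSumSquares hq, hcard]

/-- The symplectic transvection `Z ↦ Z + a ω(X, Z) X`. -/
def transvection {θ : V →L[ℝ] V →L[ℝ] ℝ} (halt : ∀ v, θ v v = 0) (a : ℝ) (X : V) : V ≃L[ℝ] V :=
  ContinuousLinearEquiv.equivOfInverse
    (ContinuousLinearMap.id ℝ V + (a • θ X).smulRight X)
    (ContinuousLinearMap.id ℝ V - (a • θ X).smulRight X)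
    (fun Z ↦ by simp [halt]) (fun Z ↦ by simp [halt])

/-- A totally symmetric cubic form on a symplectic vector space which is compatible with all complex
structures `j` of the given signature vanishes. -/
theorem eq_zero_of_forall_isTwistor [FiniteDimensional ℝ V] [T2Space V] {θ : V →L[ℝ] V →L[ℝ] ℝ}
    (halt : ∀ v, θ v v = 0) (hnd : ∀ v, (∀ w, θ v w = 0) → v = 0) {n l : ℕ}
    (hn : Module.finrank ℝ V = 2 * n) (hl : l ≤ n) {S : V →L[ℝ] V →L[ℝ] V}
    (hsymm : ∀ X Y, S X Y = S Y X) (hskew : ∀ X Y Z, θ (S X Y) Z = θ (S X Z) Y)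
    (hS : ∀ j, IsTwistor θ l j → ∀ X Y, S (j X) (j Y) - j (S (j X) Y) = j (S X (j Y)) + S X Y) :
    S = 0 := by
  have hneg : ∀ x y, θ x y = -θ y x := fun x y ↦ by
    have := halt (x + y)
    simp only [map_add, add_apply, halt] at this
    linarith
  have h12 : ∀ X Y Z, θ (S X Y) Z = θ (S Y X) Z := fun X Y Z ↦ by rw [hsymm]
  -- The hypothesis with Y = X, paired with X: since j is θ-skew, the three terms containing jX
  -- twice are all T(X,jX,jX), where T(X,Y,Z) = θ(S X Y, Z).
  have h1 : ∀ j, IsTwistor θ l j → ∀ X, θ (S X X) X = 3 * θ (S X (j X)) (j X) := by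
    intro j hj X
    have hjA : ∀ A, θ (j A) X = -θ A (j X) := fun A ↦ by
      rw [← hj.compat A (j X), hj.sq, map_neg, neg_neg]
    have := congrArg (fun v ↦ θ v X) (hS j hj X X)
    simp only [map_sub, map_add, sub_apply, add_apply, hjA] at this
    have e1 := hskew (j X) (j X) X
    have e2 := h12 (j X) X (j X)
    linarith
  -- The transvection along X fixes X, so the conjugated structure sends X to jX + aθ(X,jX)X, with
  -- `a` arbitrary.
  have h2 : ∀ j, IsTwistor θ l j → ∀ X, θ X (j X) ≠ 0 → θ (S X X) X = 0 := by
    intro j hj X hq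
    have hja : ∀ a : ℝ, θ (S X X) X = 3 * θ (S X (j X + (a * θ X (j X)) • X))
        (j X + (a * θ X (j X)) • X) := by
      intro a
      have hg : ∀ x y, θ (transvection halt a X x) (transvection halt a X y) = θ x y := by
        intro x y
        simp only [transvection, ContinuousLinearEquiv.equivOfInverse_apply, add_apply, smul_apply,
          ContinuousLinearMap.id_apply, ContinuousLinearMap.smulRight_apply, map_add, map_smul, halt,
          smul_eq_mul, hneg x X]
        ring
      have := h1 _ (hj.conj (transvection halt a X) hg) X
      have hX : (transvection halt a X).symm X = X := by
        rw [ContinuousLinearEquiv.symm_apply_eq]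
        simp [transvection, halt]
      simpa [hX, transvection, halt] using this
    have e0 := hja 0
    have e1 := hja 1
    have e2 := hja (-1)
    have e3 := hskew X X (j X)
    simp only [map_add, map_smul, add_apply, smul_apply, smul_eq_mul, zero_mul, one_mul, zero_smul,
      add_zero, e3] at e0 e1 e2
    -- The second difference `e1 + e2 - 2 * e0` retains only the a² coefficient.
    have : (θ X (j X)) ^ 2 * θ (S X X) X = 0 := by linarith
    simpa [hq] using this
  obtain ⟨j, hj⟩ := exists_isTwistor halt hnd hn hl
  have h3 : ∀ X, θ (S X X) X = 0 := by
    intro X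
    by_cases hX : X = 0
    · simp [hX]
    by_cases hq : θ X (j X) = 0
    swap
    · exact h2 j hj X hq
    have : ∃ Y, θ X Y ≠ 0 := by
      by_contra! hc
      exact hX (hnd X hc)
    obtain ⟨Y, hY⟩ := this
    obtain ⟨Z, rfl⟩ : ∃ Z, Y = j Z := ⟨-j Y, by simp [hj.sq]⟩
    have hsym : θ Z (j X) = θ X (j Z) := by
      rw [← hj.compat Z (j X), hj.sq, map_neg, hneg (j Z), neg_neg]
    -- The cubic along the line X + sZ. The direction Z is chosen so that θ(·, j·) is non-null on
    -- this line for small s ≠ 0; hence F vanishes there, and F(0) = 0 in the limit.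
    let F : ℝ → ℝ := fun s ↦ θ (S X X) X + 3 * s * θ (S X X) Z + 3 * s ^ 2 * θ (S X Z) Z
      + s ^ 3 * θ (S Z Z) Z
    have hF : ∀ s : ℝ, θ (S (X + s • Z) (X + s • Z)) (X + s • Z) = F s := by
      intro s
      have e1 := hskew X X Z
      have e2 := h12 Z X X
      have e3 := h12 Z X Z
      have e4 := hskew Z Z X
      simp only [F, map_add, map_smul, add_apply, smul_apply, smul_eq_mul]
      rw [e4, e3, e2, ← e1]
      ring
    have hev : ∀ᶠ s in 𝓝[≠] (0 : ℝ), F s = 0 := by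
      have hc : ∀ᶠ s in 𝓝 (0 : ℝ), 2 * θ X (j Z) + s * θ Z (j Z) ≠ 0 := by
        refine ContinuousAt.eventually_ne (by fun_prop) ?_
        simpa using hY
      filter_upwards [hc.filter_mono nhdsWithin_le_nhds, self_mem_nhdsWithin] with s hs hs0
      rw [← hF]
      refine h2 j hj _ ?_
      have : θ (X + s • Z) (j (X + s • Z)) = s * (2 * θ X (j Z) + s * θ Z (j Z)) := by
        simp only [map_add, map_smul, add_apply, smul_apply, smul_eq_mul, hsym, hq]
        ring
      rw [this]
      exact mul_ne_zero hs0 hs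
    have hcont : Filter.Tendsto F (𝓝[≠] 0) (𝓝 (F 0)) :=
      (show Continuous F by fun_prop).continuousAt.tendsto.mono_left nhdsWithin_le_nhds
    have : F 0 = 0 := tendsto_nhds_unique hcont
      (tendsto_const_nhds.congr' (hev.mono fun s hs ↦ hs.symm))
    simpa [F] using this
  -- T(X+Y)³ - T(X-Y)³ = 6T(X,X,Y) + 2T(Y,Y,Y), where a cube means the cubic on the diagonal.
  have h4 : ∀ X Y, θ (S X X) Y = 0 := by
    intro X Y
    have a1 := h3 (X + Y)
    have a2 := h3 (X - Y)
    have e1 := hskew X X Y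
    have e2 := h12 Y X X
    have e3 := h12 Y X Y
    have e4 := hskew Y Y X
    have a3 := h3 X
    have a4 := h3 Y
    simp only [map_add, map_sub, add_apply, sub_apply] at a1 a2
    linarith
  ext X Y
  refine hnd _ fun Z ↦ ?_
  have a1 := h4 (X + Y) Z
  have e2 := h12 Y X Z
  simp only [map_add, add_apply, h4] at a1
  linarith

end ComplexStructures

/-! ### Connections, dσ and Σ in the preferred trivializations -/

section

variable {E : Type*} [NormedAddCommGroup E] [NormedSpace ℝ E] [FiniteDimensional ℝ E]
  {M : Type*} [TopologicalSpace M] [ChartedSpace E M] [IsManifold 𝓘(ℝ, E) ∞ M]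
  {M₁ : Type*} [TopologicalSpace M₁] [ChartedSpace E M₁] [IsManifold 𝓘(ℝ, E) ∞ M₁]

lemma trivializationAt_self_apply {x : M} (v : TangentSpace 𝓘(ℝ, E) x) :
    (trivializationAt E (TangentSpace 𝓘(ℝ, E)) x ⟨x, v⟩).2 = v := by
  have h := congr($(TangentBundle.continuousLinearMapAt_trivializationAt_eq_core (I := 𝓘(ℝ, E))
    (mem_chart_source E x)) v)
  have hx : x ∈ (trivializationAt E (TangentSpace 𝓘(ℝ, E)) x).baseSet :=
    FiberBundle.mem_baseSet_trivializationAt' x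
  rw [Trivialization.continuousLinearMapAt_apply, Trivialization.linearMapAt_apply, if_pos hx] at h
  exact h.trans ((tangentBundleCore 𝓘(ℝ, E) M).coordChange_self (achart E x) x
    (mem_chart_source E x) v)

/-- A covariant derivative in the preferred trivialization at `x`. -/
lemma covariantDerivative_eq_add_christoffel (D : LinConnection E M) {x : M}
    {s : ∀ x : M, TangentSpace 𝓘(ℝ, E) x} (hs : MDiffAt (T% s) x) (X : TangentSpace 𝓘(ℝ, E) x)
    {w : E} (hw : w = christoffel D x X (s x)) :
    d% (fun z ↦ (trivializationAt E (TangentSpace 𝓘(ℝ, E)) x ⟨z, s z⟩).2) x X + w = D s x X := by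
  set e := trivializationAt E (TangentSpace 𝓘(ℝ, E)) x
  have hx : x ∈ e.baseSet := FiberBundle.mem_baseSet_trivializationAt' x
  let F : (∀ x : M, TangentSpace 𝓘(ℝ, E) x) → M → E := fun s z ↦ (e ⟨z, s z⟩).2
  have hcongr : ∀ {f g : M → E}, f =ᶠ[𝓝 x] g → d% f x X = d% g x X := fun {f g} h ↦ by
    change mfderiv 𝓘(ℝ, E) 𝓘(ℝ, E) f x X = mfderiv 𝓘(ℝ, E) 𝓘(ℝ, E) g x X
    rw [h.mfderiv_eq]
    rfl
  let T : (∀ x : M, TangentSpace 𝓘(ℝ, E) x) → E := fun s ↦ D s x X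
  let Φ : (∀ x : M, TangentSpace 𝓘(ℝ, E) x) → E := fun s ↦ T s - d% (F s) x X
  have hF : ∀ {σ : ∀ x : M, TangentSpace 𝓘(ℝ, E) x}, MDiffAt (T% σ) x → MDiffAt (F σ) x :=
    fun hσ ↦ (mdifferentiableAt_section _ _).1 hσ
  have hFe : ∀ (σ : ∀ x : M, TangentSpace 𝓘(ℝ, E) x), ∀ z ∈ e.baseSet,
      F σ z = e.continuousLinearMapAt ℝ z (σ z) := fun σ z hz ↦ by
    rw [Trivialization.continuousLinearMapAt_apply, Trivialization.linearMapAt_apply, if_pos hz]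
  -- The Leibniz terms of `D` and of the coordinate derivative cancel, so Φ(s) depends only on s(x)
  -- and may be computed on the extension of s(x).
  have hΦ : TensorialAt 𝓘(ℝ, E) E Φ x := by
    constructor
    · intro f σ hf hσ
      have h1 : d% (F (f • σ)) x X = d% (f • F σ) x X := by
        refine hcongr ?_
        filter_upwards [e.open_baseSet.mem_nhds hx] with z hz
        rw [hFe _ z hz, Pi.smul_apply', Pi.smul_apply', map_smul, hFe _ z hz]
      have h2 : T (f • σ) = f x • T σ + d% f x X • F σ x := by
        have h3 := congr($(D.isCovariantDerivativeOnUniv.leibniz hσ hf) X)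
        refine h3.trans ?_
        rw [show F σ x = σ x from trivializationAt_self_apply _]
        rfl
      simp only [Φ, h1, h2, mvfderiv_smul hf (hF hσ), add_apply, smul_apply,
        ContinuousLinearMap.smulRight_apply]
      module
    · intro σ σ' hσ hσ'
      have h1 : d% (F (σ + σ')) x X = d% (F σ + F σ') x X := by
        refine hcongr ?_
        filter_upwards [e.open_baseSet.mem_nhds hx] with z hz
        rw [hFe _ z hz, Pi.add_apply, Pi.add_apply, map_add, hFe _ z hz, hFe _ z hz]
      have h2 : T (σ + σ') = T σ + T σ' :=
        congr($(D.isCovariantDerivativeOnUniv.add hσ hσ') X)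
      simp only [Φ, h1, h2, mvfderiv_add (hF hσ) (hF hσ'), add_apply]
      abel
  have := hΦ.pointwise hs (FiberBundle.mdifferentiableAt_extend 𝓘(ℝ, E) E (s x)) (by simp)
  -- The extension is constant in the trivialization.
  have h2 : d% (F (FiberBundle.extend E (s x))) x X = 0 := by
    rw [hcongr (g := fun _ ↦ F s x), mvfderiv_const]
    · rfl
    · filter_upwards [e.open_baseSet.mem_nhds hx] with z hz
      have h := congrArg Prod.snd (e.apply_mk_symm hz (F s x))
      exact h
  simp only [Φ, h2] at this
  have hw' : w = T (FiberBundle.extend E (s x)) := hw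
  change d% (F s) x X + w = T s
  rw [hw', ← sub_zero (T (FiberBundle.extend E (s x))), ← this]
  abel

/-- The coordinate expression of `dσ` in the preferred trivializations at `x` and `σ x`. -/
def diffeoCoord (σ : M ≃ₘ^∞⟮𝓘(ℝ, E), 𝓘(ℝ, E)⟯ M₁) (x z : M) : E →L[ℝ] E :=
  ContinuousLinearMap.inCoordinates E (TangentSpace 𝓘(ℝ, E)) E (TangentSpace 𝓘(ℝ, E))
    x z (σ x) (σ z) (dEquiv σ z : _ →L[ℝ] _)

/-- The coordinate expression of an endomorphism in the preferred trivialization at `x`. -/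
def endCoord (x : M) (p : EndT E M) : E →L[ℝ] E :=
  ContinuousLinearMap.inCoordinates E (TangentSpace 𝓘(ℝ, E)) E (TangentSpace 𝓘(ℝ, E))
    x p.proj x p.proj p.snd

lemma hasMFDerivAt_proj (j : EndT E M) :
    HasMFDerivAt (endModel E) 𝓘(ℝ, E) (TotalSpace.proj : EndT E M → M) j
      (ContinuousLinearMap.fst ℝ E (E →L[ℝ] E)) := by
  have h : HasMFDerivAt (endModel E) 𝓘(ℝ, E) (TotalSpace.proj : EndT E M → M) j _ :=
    ((contMDiff_proj (n := 1) (IB := 𝓘(ℝ, E)) _).mdifferentiable one_ne_zero j).hasMFDerivAt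
  exact h.congr_mfderiv (ContinuousLinearMap.ext fun u ↦ baseDir_eq u)

/-- The second component of the preferred chart of End(TM) at `j` is `endCoord`, so in that chart
the map is a linear projection. -/
lemma hasMFDerivAt_endCoord (j : EndT E M) :
    HasMFDerivAt (endModel E) 𝓘(ℝ, E →L[ℝ] E) (endCoord (E := E) (M := M) j.proj) j
      (ContinuousLinearMap.snd ℝ E (E →L[ℝ] E)) := by
  have hid : ∀ j : EndT E M, MDifferentiableAt (endModel E) (endModel E) (id : EndT E M → EndT E M) j :=
    fun j ↦ mdifferentiableAt_id
  have hc := ((mdifferentiableAt_hom_bundle (id : EndT E M → EndT E M)).1 (hid j)).2.continuousAt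
  refine ⟨hc, ?_⟩
  have h0 : HasFDerivWithinAt (Prod.snd : E × (E →L[ℝ] E) → (E →L[ℝ] E))
    (ContinuousLinearMap.snd ℝ E (E →L[ℝ] E)) (Set.range (endModel E))
    (extChartAt (endModel E) j j) := hasFDerivWithinAt_snd
  have key : ∀ p ∈ (extChartAt (endModel E) j).source,
      (extChartAt (endModel E) j p).2 = endCoord j.proj p := by
    intro p hp
    rw [FiberBundle.extChartAt]
    simp only [mfld_simps, hom_trivializationAt_apply]
    rfl
  refine h0.congr_of_eventuallyEq ?_ ?_
  · filter_upwards [extChartAt_target_mem_nhdsWithin (I := endModel E) j] with z hz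
    simp only [writtenInExtChartAt, Function.comp_apply, extChartAt_model_space_eq_id, PartialEquiv.refl_coe, id]
    rw [← key _ ((extChartAt (endModel E) j).map_target hz), (extChartAt (endModel E) j).right_inv hz]
  · simp only [writtenInExtChartAt, Function.comp_apply, extChartAt_to_inv, extChartAt_model_space_eq_id, PartialEquiv.refl_coe, id]
    rw [← key _ (mem_extChartAt_source j)]

lemma mdifferentiableAt_diffeoCoord (σ : M ≃ₘ^∞⟮𝓘(ℝ, E), 𝓘(ℝ, E)⟯ M₁) (x : M) :
    MDifferentiableAt 𝓘(ℝ, E) 𝓘(ℝ, E →L[ℝ] E) (diffeoCoord σ x) x := by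
  have h : ContMDiffAt 𝓘(ℝ, E) 𝓘(ℝ, E →L[ℝ] E) 1 _ x :=
    (σ.contMDiff x).mfderiv_const (m := 1) (WithTop.coe_le_coe.2 (le_top : (2 : ℕ∞) ≤ ⊤))
  exact h.mdifferentiableAt one_ne_zero

lemma inCoordinates_self (x : M) (y : M₁) (A : TangentSpace 𝓘(ℝ, E) x →L[ℝ] TangentSpace 𝓘(ℝ, E) y) :
    ContinuousLinearMap.inCoordinates E (TangentSpace 𝓘(ℝ, E)) E (TangentSpace 𝓘(ℝ, E)) x x y y A
      = A := by
  rw [ContinuousLinearMap.inCoordinates, TangentBundle.continuousLinearMapAt_trivializationAt_eq_core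
     (mem_chart_source E y), TangentBundle.symmL_trivializationAt_eq_core
     (mem_chart_source E x)]
  have h (v) := (tangentBundleCore 𝓘(ℝ, E) M).coordChange_self (achart E x) x
    (mem_chart_source E x) v
  have h' (v) := (tangentBundleCore 𝓘(ℝ, E) M₁).coordChange_self (achart E y) y
    (mem_chart_source E y) v
  refine ContinuousLinearMap.ext fun v ↦ ?_
  exact (h' _).trans (congrArg A (h v))

lemma eventually_mem_baseSet (σ : M ≃ₘ^∞⟮𝓘(ℝ, E), 𝓘(ℝ, E)⟯ M₁) (x : M) : ∀ᶠ z in 𝓝 x,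
    z ∈ (trivializationAt E (TangentSpace 𝓘(ℝ, E)) x).baseSet ∧
    σ z ∈ (trivializationAt E (TangentSpace 𝓘(ℝ, E)) (σ x)).baseSet := by
  refine Filter.Eventually.and ((trivializationAt E (TangentSpace 𝓘(ℝ, E)) x).open_baseSet.mem_nhds
    (FiberBundle.mem_baseSet_trivializationAt' x)) ?_
  exact σ.continuous.continuousAt.eventually
    ((trivializationAt E (TangentSpace 𝓘(ℝ, E)) (σ x)).open_baseSet.mem_nhds
    (FiberBundle.mem_baseSet_trivializationAt' (σ x)))

/-- The coordinate expression of `dσ⁻¹` in the preferred trivializations at `σ x` and `x`. -/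
def diffeoCoordInv (σ : M ≃ₘ^∞⟮𝓘(ℝ, E), 𝓘(ℝ, E)⟯ M₁) (x z : M) : E →L[ℝ] E :=
  ContinuousLinearMap.inCoordinates E (TangentSpace 𝓘(ℝ, E)) E (TangentSpace 𝓘(ℝ, E))
    (σ x) (σ z) x z ((dEquiv σ z).symm : _ →L[ℝ] _)

lemma inCoordinates_comp {M₂ : Type*} [TopologicalSpace M₂] [ChartedSpace E M₂]
    [IsManifold 𝓘(ℝ, E) ∞ M₂] {x₀ x : M} {y₀ y : M₁} {z₀ z : M₂}
    (hy : y ∈ (trivializationAt E (TangentSpace 𝓘(ℝ, E)) y₀).baseSet)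
    (f : TangentSpace 𝓘(ℝ, E) y →L[ℝ] TangentSpace 𝓘(ℝ, E) z)
    (g : TangentSpace 𝓘(ℝ, E) x →L[ℝ] TangentSpace 𝓘(ℝ, E) y) :
    ContinuousLinearMap.inCoordinates E (TangentSpace 𝓘(ℝ, E)) E (TangentSpace 𝓘(ℝ, E))
        x₀ x z₀ z (f ∘L g) =
      ContinuousLinearMap.inCoordinates E (TangentSpace 𝓘(ℝ, E)) E (TangentSpace 𝓘(ℝ, E))
        y₀ y z₀ z f ∘L
      ContinuousLinearMap.inCoordinates E (TangentSpace 𝓘(ℝ, E)) E (TangentSpace 𝓘(ℝ, E))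
        x₀ x y₀ y g := by
  ext v
  simp only [ContinuousLinearMap.inCoordinates, ContinuousLinearMap.comp_apply]
  rw [Trivialization.symmL_continuousLinearMapAt _ hy]

lemma inCoordinates_id {x₀ x : M}
    (hx : x ∈ (trivializationAt E (TangentSpace 𝓘(ℝ, E)) x₀).baseSet) :
    ContinuousLinearMap.inCoordinates E (TangentSpace 𝓘(ℝ, E)) E (TangentSpace 𝓘(ℝ, E))
        x₀ x x₀ x (ContinuousLinearMap.id ℝ (TangentSpace 𝓘(ℝ, E) x)) = 1 := by
  ext v
  simp only [ContinuousLinearMap.inCoordinates, ContinuousLinearMap.comp_apply,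
    ContinuousLinearMap.id_apply]
  rw [Trivialization.continuousLinearMapAt_symmL _ hx]
  rfl

lemma diffeoCoord_mul_inv (σ : M ≃ₘ^∞⟮𝓘(ℝ, E), 𝓘(ℝ, E)⟯ M₁) {x z : M}
    (hz : z ∈ (trivializationAt E (TangentSpace 𝓘(ℝ, E)) x).baseSet)
    (hz' : σ z ∈ (trivializationAt E (TangentSpace 𝓘(ℝ, E)) (σ x)).baseSet) :
    diffeoCoord σ x z * diffeoCoordInv σ x z = 1 ∧ diffeoCoordInv σ x z * diffeoCoord σ x z = 1 := by
  constructor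
  · refine (inCoordinates_comp hz _ _).symm.trans ?_
    rw [ContinuousLinearEquiv.coe_comp_coe_symm, inCoordinates_id hz']
  · refine (inCoordinates_comp hz' _ _).symm.trans ?_
    rw [ContinuousLinearEquiv.coe_symm_comp_coe, inCoordinates_id hz]

lemma endCoord_twistorMap (σ : M ≃ₘ^∞⟮𝓘(ℝ, E), 𝓘(ℝ, E)⟯ M₁) {x : M} {p : EndT E M}
    (hz : p.proj ∈ (trivializationAt E (TangentSpace 𝓘(ℝ, E)) x).baseSet) :
    endCoord (σ x) (twistorMap σ p) =
      diffeoCoord σ x p.proj * (endCoord x p * diffeoCoordInv σ x p.proj) := by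
  refine (inCoordinates_comp hz _ _).trans (congrArg _ (inCoordinates_comp hz _ _))

/-- The derivative at `x` of the coordinate expression of `dσ`. -/
def diffeoCoordDeriv (σ : M ≃ₘ^∞⟮𝓘(ℝ, E), 𝓘(ℝ, E)⟯ M₁) (x : M) : E →L[ℝ] E →L[ℝ] E :=
  mfderiv 𝓘(ℝ, E) 𝓘(ℝ, E →L[ℝ] E) (diffeoCoord σ x) x

lemma hasMFDerivAt_diffeoCoord (σ : M ≃ₘ^∞⟮𝓘(ℝ, E), 𝓘(ℝ, E)⟯ M₁) (x : M) :
    HasMFDerivAt 𝓘(ℝ, E) 𝓘(ℝ, E →L[ℝ] E) (diffeoCoord σ x) x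
      (diffeoCoordDeriv (E := E) σ x) :=
  (mdifferentiableAt_diffeoCoord σ x).hasMFDerivAt

/-- The derivative at `x` of the coordinate expression of `dσ⁻¹`. -/
def diffeoCoordInvDeriv (σ : M ≃ₘ^∞⟮𝓘(ℝ, E), 𝓘(ℝ, E)⟯ M₁) (x : M) : E →L[ℝ] E →L[ℝ] E :=
  (-ContinuousLinearMap.mulLeftRight ℝ (E →L[ℝ] E) (diffeoCoordInv σ x x)
    (diffeoCoordInv σ x x)) ∘L diffeoCoordDeriv σ x

lemma diffeoCoordInvDeriv_apply (σ : M ≃ₘ^∞⟮𝓘(ℝ, E), 𝓘(ℝ, E)⟯ M₁) (x : M) (X : E) :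
    diffeoCoordInvDeriv σ x X =
      -(diffeoCoordInv σ x x * diffeoCoordDeriv σ x X * diffeoCoordInv σ x x) := rfl

/-- Near `x` the coordinate matrix of dσ⁻¹ is the ring inverse of that of dσ, whence the formula -H
G' H for its derivative. -/
lemma hasMFDerivAt_diffeoCoordInv (σ : M ≃ₘ^∞⟮𝓘(ℝ, E), 𝓘(ℝ, E)⟯ M₁) (x : M) :
    HasMFDerivAt 𝓘(ℝ, E) 𝓘(ℝ, E →L[ℝ] E) (diffeoCoordInv σ x) x
      (diffeoCoordInvDeriv (E := E) σ x) := by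
  have h := eventually_mem_baseSet σ x
  obtain ⟨h1, h2⟩ := diffeoCoord_mul_inv σ h.self_of_nhds.1 h.self_of_nhds.2
  let u : (E →L[ℝ] E)ˣ := ⟨_, _, h1, h2⟩
  have hinv : HasMFDerivAt 𝓘(ℝ, E →L[ℝ] E) 𝓘(ℝ, E →L[ℝ] E) Ring.inverse (diffeoCoord σ x x) _ :=
    (hasFDerivAt_ringInverse (𝕜 := ℝ) u).hasMFDerivAt
  refine (hinv.comp x (hasMFDerivAt_diffeoCoord σ x)).congr_of_eventuallyEq ?_
  filter_upwards [h] with z hz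
  obtain ⟨h1, h2⟩ := diffeoCoord_mul_inv σ hz.1 hz.2
  exact (Ring.inverse_unit (⟨_, _, h1, h2⟩ : (E →L[ℝ] E)ˣ)).symm

lemma hasMFDerivAt_endCoord_twistorMap (σ : M ≃ₘ^∞⟮𝓘(ℝ, E), 𝓘(ℝ, E)⟯ M₁) (j : EndT E M) :
    ∃ L : E × (E →L[ℝ] E) →L[ℝ] (E →L[ℝ] E),
      HasMFDerivAt (endModel E) 𝓘(ℝ, E →L[ℝ] E)
        (fun p ↦ endCoord (σ j.proj) (twistorMap σ p)) j L ∧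
      ∀ X B, L (X, B) = diffeoCoord σ j.proj j.proj *
          (endCoord j.proj j * diffeoCoordInvDeriv σ j.proj X + B * diffeoCoordInv σ j.proj j.proj)
        + diffeoCoordDeriv σ j.proj X * (endCoord j.proj j * diffeoCoordInv σ j.proj j.proj) := by
  have h1 := (hasMFDerivAt_diffeoCoord σ j.proj).comp j (hasMFDerivAt_proj j)
  have h2 := (hasMFDerivAt_diffeoCoordInv σ j.proj).comp j (hasMFDerivAt_proj j)
  refine ⟨_, (h1.mul' ((hasMFDerivAt_endCoord j).mul' h2)).congr_of_eventuallyEq ?_, ?_⟩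
  · filter_upwards [(hasMFDerivAt_proj j).continuousAt.eventually
      (eventually_mem_baseSet σ j.proj)] with p hp
    exact endCoord_twistorMap σ hp.1
  · intro X B
    rfl

lemma mdifferentiableAt_twistorMap (σ : M ≃ₘ^∞⟮𝓘(ℝ, E), 𝓘(ℝ, E)⟯ M₁) (j : EndT E M) :
    MDifferentiableAt (endModel E) (endModel E) (twistorMap σ) j := by
  rw [mdifferentiableAt_hom_bundle]
  obtain ⟨L, hL, -⟩ := hasMFDerivAt_endCoord_twistorMap σ j
  exact ⟨(σ.mdifferentiable (by simp) j.proj).comp j (hasMFDerivAt_proj j).mdifferentiableAt,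
    hL.mdifferentiableAt⟩

/-- Reduces derivatives of maps into End(TM) to those of the base point and of the matrix. -/
lemma mfderiv_eq_prod {N : Type*} [TopologicalSpace N] {F H : Type*} [NormedAddCommGroup F]
    [NormedSpace ℝ F] [TopologicalSpace H] {I : ModelWithCorners ℝ F H} [ChartedSpace H N]
    {c : N → EndT E M} {t : N} (hc : MDifferentiableAt I (endModel E) c t) {L₁ : F →L[ℝ] E}
    {L₂ : F →L[ℝ] E →L[ℝ] E} (h₁ : HasMFDerivAt I 𝓘(ℝ, E) (fun t ↦ (c t).proj) t L₁)
    (h₂ : HasMFDerivAt I 𝓘(ℝ, E →L[ℝ] E) (fun s ↦ endCoord (c t).proj (c s)) t L₂) (v : F) :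
    mfderiv I (endModel E) c t v = (L₁ v, L₂ v) := by
  have e1 := hasMFDerivAt_unique ((hasMFDerivAt_proj (c t)).comp t hc.hasMFDerivAt) h₁
  have e2 := hasMFDerivAt_unique ((hasMFDerivAt_endCoord (c t)).comp t hc.hasMFDerivAt) h₂
  exact Prod.ext congr($e1 v) congr($e2 v)

/-- The product rule for the coordinate form A ↦ G A H of Σ, where G and H = G⁻¹ vary with the base
point. -/
lemma mfderiv_twistorMap (σ : M ≃ₘ^∞⟮𝓘(ℝ, E), 𝓘(ℝ, E)⟯ M₁) (j : EndT E M) (X : E) (B : E →L[ℝ] E) :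
    mfderiv (endModel E) (endModel E) (twistorMap σ) j ((X, B) : E × (E →L[ℝ] E)) =
      ((diffeoCoord σ j.proj j.proj X, diffeoCoord σ j.proj j.proj *
          (endCoord j.proj j * diffeoCoordInvDeriv σ j.proj X + B * diffeoCoordInv σ j.proj j.proj)
        + diffeoCoordDeriv σ j.proj X * (endCoord j.proj j * diffeoCoordInv σ j.proj j.proj)) :
          E × (E →L[ℝ] E)) := by
  obtain ⟨L, hL, hL'⟩ := hasMFDerivAt_endCoord_twistorMap σ j
  have h1 : HasMFDerivAt (endModel E) 𝓘(ℝ, E) (fun p ↦ (twistorMap σ p).proj) j _ :=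
    ((σ.mdifferentiable (by simp) j.proj).hasMFDerivAt).comp j (hasMFDerivAt_proj j)
  refine (mfderiv_eq_prod (mdifferentiableAt_twistorMap σ j) h1 hL (X, B)).trans ?_
  rw [hL']
  refine Prod.ext ?_ rfl
  exact congr($(inCoordinates_self j.proj (σ j.proj) (dEquiv σ j.proj : _ →L[ℝ] _)) X).symm

end

/-! ### Naturality of horizontal and vertical lifts -/

section

variable {E : Type*} [NormedAddCommGroup E] [NormedSpace ℝ E] [FiniteDimensional ℝ E]
  {M : Type*} [TopologicalSpace M] [ChartedSpace E M] [IsManifold 𝓘(ℝ, E) ∞ M]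
  {M₁ : Type*} [TopologicalSpace M₁] [ChartedSpace E M₁] [IsManifold 𝓘(ℝ, E) ∞ M₁]

lemma dEquiv_symm_apply_dEquiv (σ : M ≃ₘ^∞⟮𝓘(ℝ, E), 𝓘(ℝ, E)⟯ M₁) (x : M)
    (X : TangentSpace 𝓘(ℝ, E) x) : dEquiv σ.symm (σ x) (dEquiv σ x X) = (X : E) := by
  have hc := mfderiv_comp (I := 𝓘(ℝ, E)) (I' := 𝓘(ℝ, E)) (I'' := 𝓘(ℝ, E)) x
    (σ.symm.mdifferentiable (by simp) (σ x)) (σ.mdifferentiable (by simp) x)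
  have hid : (σ.symm ∘ σ : M → M) = id := by funext z; simp
  rw [hid, mfderiv_id] at hc
  exact congr($hc X).symm

lemma mpullback_diffeomorph_apply (σ : M ≃ₘ^∞⟮𝓘(ℝ, E), 𝓘(ℝ, E)⟯ M₁)
    (Y : ∀ y : M₁, TangentSpace 𝓘(ℝ, E) y) (x : M) :
    mpullback 𝓘(ℝ, E) 𝓘(ℝ, E) σ Y x = (dEquiv σ x).symm (Y (σ x)) := by
  rw [mpullback_apply, ← Diffeomorph.mfderivToContinuousLinearEquiv_coe σ (by simp),
    ContinuousLinearMap.inverse_equiv]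
  rfl

lemma pushConnection_apply (σ : M ≃ₘ^∞⟮𝓘(ℝ, E), 𝓘(ℝ, E)⟯ M₁) (D : LinConnection E M)
    (Y : ∀ y : M₁, TangentSpace 𝓘(ℝ, E) y) (x : M) (X : TangentSpace 𝓘(ℝ, E) x) :
    pushConnection σ D Y (σ x) (dEquiv σ x X) =
      dEquiv σ x (D (mpullback 𝓘(ℝ, E) 𝓘(ℝ, E) σ Y) x X) := by
  change (dEquiv σ.symm (σ x)).symm (D (mpullback 𝓘(ℝ, E) 𝓘(ℝ, E) σ Y) (σ.symm (σ x))
    (dEquiv σ.symm (σ x) (dEquiv σ x X))) = _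
  rw [ContinuousLinearEquiv.symm_apply_eq]
  refine Eq.trans ?_ (dEquiv_symm_apply_dEquiv σ x _).symm
  -- Typed with values in the model space, so that the base point can be rewritten without changing
  -- the type.
  let F : M → E →L[ℝ] E := D (mpullback 𝓘(ℝ, E) 𝓘(ℝ, E) σ Y)
  have h1 : F (σ.symm (σ x)) = F x := congrArg F (σ.symm_apply_apply x)
  exact congr($h1 $(dEquiv_symm_apply_dEquiv σ x X))

lemma diffeoCoord_self (σ : M ≃ₘ^∞⟮𝓘(ℝ, E), 𝓘(ℝ, E)⟯ M₁) (x : M) :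
    diffeoCoord σ x x =
      (dEquiv σ x : TangentSpace 𝓘(ℝ, E) x →L[ℝ] TangentSpace 𝓘(ℝ, E) (σ x)) :=
  inCoordinates_self _ _ _

lemma diffeoCoordInv_self (σ : M ≃ₘ^∞⟮𝓘(ℝ, E), 𝓘(ℝ, E)⟯ M₁) (x : M) :
    diffeoCoordInv σ x x =
      ((dEquiv σ x).symm : TangentSpace 𝓘(ℝ, E) (σ x) →L[ℝ] TangentSpace 𝓘(ℝ, E) x) :=
  inCoordinates_self _ _ _

/-- The Christoffel symbol of `D` in the preferred trivialization, as an endomorphism of the model. -/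
def christoffelCoord (D : LinConnection E M) (x : M) (X : E) : E →L[ℝ] E := christoffel D x X

lemma mdifferentiableAt_mpullback (σ : M ≃ₘ^∞⟮𝓘(ℝ, E), 𝓘(ℝ, E)⟯ M₁)
    {Y : ∀ y : M₁, TangentSpace 𝓘(ℝ, E) y} {x : M} (hY : MDiffAt (T% Y) (σ x)) :
    MDiffAt (T% (mpullback 𝓘(ℝ, E) 𝓘(ℝ, E) σ Y)) x :=
  MDifferentiableAt.mpullback_vectorField (n := ∞) hY (σ.contMDiff _) ⟨dEquiv σ x, rfl⟩
    (WithTop.coe_le_coe.2 (le_top : (2 : ℕ∞) ≤ ⊤))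

/-- Transformation law of Christoffel symbols. The pull-back of a field constant in the
trivialization at σ(x) with value `w` has coordinates H(z)w, which is then differentiated by
`covariantDerivative_eq_add_christoffel`. -/
lemma christoffelCoord_pushConnection (σ : M ≃ₘ^∞⟮𝓘(ℝ, E), 𝓘(ℝ, E)⟯ M₁) (D : LinConnection E M)
    (x : M) (X : TangentSpace 𝓘(ℝ, E) x) :
    christoffelCoord (pushConnection σ D) (σ x) (diffeoCoord σ x x X) =
      diffeoCoord σ x x * (diffeoCoordInvDeriv σ x X
        + christoffelCoord D x X * diffeoCoordInv σ x x) := by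
  ext w
  set Y := FiberBundle.extend E (E := TangentSpace 𝓘(ℝ, E)) (x := σ x) w
  have h1 : christoffelCoord (pushConnection σ D) (σ x) (diffeoCoord σ x x X) w =
      pushConnection σ D Y (σ x) (dEquiv σ x X) := by
    rw [diffeoCoord_self]
    rfl
  have hY := mdifferentiableAt_mpullback σ
    (FiberBundle.mdifferentiableAt_extend 𝓘(ℝ, E) E (x := σ x) w)
  have hx := eventually_mem_baseSet σ x
  have hd : d% (fun z ↦ (trivializationAt E (TangentSpace 𝓘(ℝ, E)) x
      ⟨z, mpullback 𝓘(ℝ, E) 𝓘(ℝ, E) σ Y z⟩).2) x X = diffeoCoordInvDeriv σ x X w := by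
    have hH : HasMFDerivAt 𝓘(ℝ, E) 𝓘(ℝ, E) (fun z ↦ diffeoCoordInv σ x z w) x _ :=
      (ContinuousLinearMap.apply ℝ E w).hasMFDerivAt.comp x (hasMFDerivAt_diffeoCoordInv σ x)
    have he : (fun z ↦ (trivializationAt E (TangentSpace 𝓘(ℝ, E)) x
      ⟨z, mpullback 𝓘(ℝ, E) 𝓘(ℝ, E) σ Y z⟩).2) =ᶠ[𝓝 x] fun z ↦ diffeoCoordInv σ x z w := by
      filter_upwards [hx] with z hz
      rw [mpullback_diffeomorph_apply, diffeoCoordInv, ContinuousLinearMap.inCoordinates,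
        ContinuousLinearMap.comp_apply, ContinuousLinearMap.comp_apply,
        Trivialization.continuousLinearMapAt_apply, Trivialization.linearMapAt_apply, if_pos hz.1,
        ContinuousLinearEquiv.coe_coe, Trivialization.symmL_apply _ hz.2]
      have hw : (trivializationAt E (TangentSpace 𝓘(ℝ, E)) (σ x) ⟨σ x, w⟩).2 = w :=
        trivializationAt_self_apply (x := σ x) w
      conv_rhs => rw [← hw]
      rfl
    exact congr($((hH.congr_of_eventuallyEq he).mfderiv) X)
  have h2 := covariantDerivative_eq_add_christoffel D hY X rfl
  rw [hd] at h2
  refine h1.trans ((pushConnection_apply σ D Y x X).trans ?_)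
  rw [diffeoCoord_self, diffeoCoordInv_self]
  refine congrArg (dEquiv σ x) (h2.symm.trans (congrArg (diffeoCoordInvDeriv σ x X w + ·) ?_))
  refine congrArg (christoffelCoord D x X) ((mpullback_diffeomorph_apply σ Y x).trans ?_)
  exact congrArg (dEquiv σ x).symm (FiberBundle.extend_apply_self E _)

/-- The inhomogeneous term of the Christoffel transformation law cancels the derivatives of G and H
in dΣ, using H' = -H G' H. -/
theorem mfderiv_twistorMap_horLift (σ : M ≃ₘ^∞⟮𝓘(ℝ, E), 𝓘(ℝ, E)⟯ M₁) (D : LinConnection E M)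
    (j : EndT E M) (X : TangentSpace 𝓘(ℝ, E) j.proj) :
    mfderiv (endModel E) (endModel E) (twistorMap σ) j (horLift D j X) =
      horLift (pushConnection σ D) (twistorMap σ j) (dEquiv σ j.proj X) := by
  have h := (eventually_mem_baseSet σ j.proj).self_of_nhds
  obtain ⟨h1, h2⟩ := diffeoCoord_mul_inv σ h.1 h.2
  have h3 := christoffelCoord_pushConnection σ D j.proj X
  have h4 : endCoord j.proj j = j.snd := inCoordinates_self _ _ _
  have h5 := diffeoCoordInvDeriv_apply σ j.proj X
  have hs : (show E →L[ℝ] E from (twistorMap σ j).snd) = diffeoCoord σ j.proj j.proj *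
      (endCoord j.proj j * diffeoCoordInv σ j.proj j.proj) := by
    rw [diffeoCoord_self, diffeoCoordInv_self, h4]
    rfl
  refine (mfderiv_twistorMap σ j X _).trans (Prod.ext ?_ ?_)
  · exact congr($(diffeoCoord_self σ j.proj) X)
  · change _ = (show E →L[ℝ] E from (twistorMap σ j).snd) *
      christoffelCoord (pushConnection σ D) (σ j.proj) (dEquiv σ j.proj X) -
      christoffelCoord (pushConnection σ D) (σ j.proj) (dEquiv σ j.proj X) *
      (show E →L[ℝ] E from (twistorMap σ j).snd)
    have h6 : (dEquiv σ j.proj X : E) = diffeoCoord σ j.proj j.proj X :=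
      congr($(diffeoCoord_self σ j.proj) X).symm
    rw [h6, h3, hs]
    change diffeoCoord σ j.proj j.proj *
          (endCoord j.proj j * diffeoCoordInvDeriv σ j.proj X +
            ((show E →L[ℝ] E from j.snd) * christoffelCoord D j.proj X
              - christoffelCoord D j.proj X * (show E →L[ℝ] E from j.snd))
                * diffeoCoordInv σ j.proj j.proj)
        + diffeoCoordDeriv σ j.proj X * (endCoord j.proj j * diffeoCoordInv σ j.proj j.proj) = _
    rw [← h4, h5]
    generalize diffeoCoord σ j.proj j.proj = G at *
    generalize diffeoCoordInv σ j.proj j.proj = H at *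
    generalize endCoord j.proj j = A at *
    generalize christoffelCoord D j.proj X = Γ at *
    generalize diffeoCoordDeriv σ j.proj X = G' at *
    have e1 : ∀ z, G * (H * z) = z := fun z ↦ by rw [← mul_assoc, h1, one_mul]
    have e2 : ∀ z, H * (G * z) = z := fun z ↦ by rw [← mul_assoc, h2, one_mul]
    simp only [mul_add, add_mul, mul_sub, sub_mul, mul_neg, neg_mul, mul_assoc, e1, e2]
    abel

theorem mfderiv_twistorMap_vertLift (σ : M ≃ₘ^∞⟮𝓘(ℝ, E), 𝓘(ℝ, E)⟯ M₁) (j : EndT E M)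
    (A : TangentSpace 𝓘(ℝ, E) j.proj →L[ℝ] TangentSpace 𝓘(ℝ, E) j.proj) :
    mfderiv (endModel E) (endModel E) (twistorMap σ) j (vertLift j A) =
      vertLift (twistorMap σ j)
        ((dEquiv σ j.proj : _ →L[ℝ] TangentSpace 𝓘(ℝ, E) (σ j.proj)) ∘L A ∘L
        ((dEquiv σ j.proj).symm : TangentSpace 𝓘(ℝ, E) (σ j.proj) →L[ℝ] _)) := by
  refine (mfderiv_twistorMap σ j 0 A).trans (Prod.ext ?_ ?_)
  · exact map_zero (diffeoCoord σ j.proj j.proj)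
  · simp only [map_zero, mul_zero, zero_mul, zero_add, add_zero]
    rw [diffeoCoord_self, diffeoCoordInv_self]
    rfl

end

/-! ### The difference of two symplectic connections -/

section

variable {E : Type*} [NormedAddCommGroup E] [NormedSpace ℝ E] [FiniteDimensional ℝ E]
  {M : Type*} [TopologicalSpace M] [ChartedSpace E M] [IsManifold 𝓘(ℝ, E) ∞ M]
  {M₁ : Type*} [TopologicalSpace M₁] [ChartedSpace E M₁] [IsManifold 𝓘(ℝ, E) ∞ M₁]

/-- Every tangent vector extends to a globally defined smooth vector field. -/
lemma exists_contMDiff_vectorField [T2Space M] {x : M} (v : TangentSpace 𝓘(ℝ, E) x) :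
    ∃ Y : ∀ x : M, TangentSpace 𝓘(ℝ, E) x, CMDiff ∞ (T% Y) ∧ Y x = v := by
  obtain ⟨s, hs, hsY⟩ := FiberBundle.exists_contMDiffOn_extend (k := ∞) 𝓘(ℝ, E) E v
  obtain ⟨f, -, hf⟩ := (SmoothBumpFunction.nhds_basis_tsupport (I := 𝓘(ℝ, E)) x).mem_iff.1
    (interior_mem_nhds.2 hs)
  refine ⟨(f : M → ℝ) • FiberBundle.extend E v, ?_, ?_⟩
  · exact ContMDiffOn.smul_section_of_tsupport (u := interior s) f.contMDiff.contMDiffOn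
      isOpen_interior hf (hsY.mono interior_subset)
  · rw [Pi.smul_apply', f.eq_one, one_smul, FiberBundle.extend_apply_self]

lemma SymplecticForm.mdifferentiable_apply (Ω : SymplecticForm E M)
    {Y Z : ∀ x : M, TangentSpace 𝓘(ℝ, E) x} (hY : CMDiff ∞ (T% Y)) (hZ : CMDiff ∞ (T% Z)) :
    MDiff (fun x ↦ Ω.toFun x (Y x) (Z x)) := by
  have h : ContMDiff 𝓘(ℝ, E) (𝓘(ℝ, E).prod 𝓘(ℝ)) ∞
      (fun m ↦ TotalSpace.mk' ℝ (E := Bundle.Trivial M ℝ) m (Ω.toFun m (Y m) (Z m))) := by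
    refine ContMDiff.clm_bundle_apply₂ (F₁ := E) (F₂ := E) ?_ hY hZ
    exact Ω.smooth
  intro x
  have := (h x).mdifferentiableAt (by simp)
  simp only [mdifferentiableAt_totalSpace] at this
  exact this.2

/-- Pull-back by a diffeomorphism commutes with the Lie bracket. -/
lemma pushConnection_torsion (σ : M ≃ₘ^∞⟮𝓘(ℝ, E), 𝓘(ℝ, E)⟯ M₁) {D : LinConnection E M}
    (hD : D.torsion = 0) : (pushConnection σ D).torsion = 0 := by
  rw [CovariantDerivative.torsion_eq_zero_iff] at hD ⊢
  intro Y Z y hY hZ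
  obtain ⟨x, rfl⟩ : ∃ x, σ x = y := σ.surjective y
  -- The bracket lemma asks for regularity `minSmoothness ℝ 2`, which equals 2 over ℝ.
  have : IsManifold 𝓘(ℝ, E) (minSmoothness ℝ 2) M := by
    rw [minSmoothness_of_isRCLikeNormedField]
    exact inferInstance
  have : IsManifold 𝓘(ℝ, E) (minSmoothness ℝ 2) M₁ := by
    rw [minSmoothness_of_isRCLikeNormedField]
    exact inferInstance
  have hb := mpullback_mlieBracket (n := ∞) hY hZ (σ.contMDiff x)
    (by simpa using WithTop.coe_le_coe.2 (le_top : (2 : ℕ∞) ≤ ⊤))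
  rw [← hD (mdifferentiableAt_mpullback σ hY) (mdifferentiableAt_mpullback σ hZ)] at hb
  have hv : ∀ V : TangentSpace 𝓘(ℝ, E) (σ x), dEquiv σ x ((dEquiv σ x).symm V) = V :=
    (dEquiv σ x).apply_symm_apply
  have h1 := pushConnection_apply σ D Z x ((dEquiv σ x).symm (Y (σ x)))
  have h2 := pushConnection_apply σ D Y x ((dEquiv σ x).symm (Z (σ x)))
  rw [hv] at h1 h2
  rw [h1, h2, ← map_sub]
  simp only [mpullback_diffeomorph_apply] at hb
  rw [← hb, hv]

/-- The identity for ∇ and the pulled-back fields, transported along σ using σ^*ω₁ = ω. -/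
lemma pushConnection_parallel (σ : M ≃ₘ^∞⟮𝓘(ℝ, E), 𝓘(ℝ, E)⟯ M₁) {Ω : SymplecticForm E M}
    {Ω₁ : SymplecticForm E M₁} (hσ : IsSymplectomorphism Ω Ω₁ σ) {D : LinConnection E M}
    (hD : IsSymplecticConnection Ω D) (X Y Z : ∀ x : M₁, TangentSpace 𝓘(ℝ, E) x)
    (hX : CMDiff ∞ (T% X)) (hY : CMDiff ∞ (T% Y)) (hZ : CMDiff ∞ (T% Z)) (y : M₁) :
      d% (fun y ↦ Ω₁.toFun y (Y y) (Z y)) y (X y) =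
        Ω₁.toFun y (pushConnection σ D Y y (X y)) (Z y)
          + Ω₁.toFun y (Y y) (pushConnection σ D Z y (X y)) := by
  obtain ⟨x, rfl⟩ : ∃ x, σ x = y := σ.surjective y
  have hv : ∀ V : TangentSpace 𝓘(ℝ, E) (σ x), dEquiv σ x ((dEquiv σ x).symm V) = V :=
    (dEquiv σ x).apply_symm_apply
  have hp : ∀ {Y : ∀ x : M₁, TangentSpace 𝓘(ℝ, E) x}, CMDiff ∞ (T% Y) →
      CMDiff ∞ (T% (mpullback 𝓘(ℝ, E) 𝓘(ℝ, E) σ Y)) := fun hY ↦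
    hY.mpullback_vectorField σ.contMDiff (fun x ↦ ⟨dEquiv σ x, rfl⟩) (by simp)
  have h := hD.parallel _ _ _ (hp hX) (hp hY) (hp hZ) x
  have hf : (fun x ↦ Ω.toFun x (mpullback 𝓘(ℝ, E) 𝓘(ℝ, E) σ Y x)
      (mpullback 𝓘(ℝ, E) 𝓘(ℝ, E) σ Z x)) = (fun y ↦ Ω₁.toFun y (Y y) (Z y)) ∘ σ := by
    funext z
    rw [mpullback_diffeomorph_apply, mpullback_diffeomorph_apply, ← hσ,
      ContinuousLinearEquiv.apply_symm_apply, ContinuousLinearEquiv.apply_symm_apply]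
    rfl
  rw [hf, mvfderiv_comp x (Ω₁.mdifferentiable_apply hY hZ _) (σ.mdifferentiable (by simp) x),
    ← hσ, ← hσ, ← pushConnection_apply, ← pushConnection_apply] at h
  simp only [mpullback_diffeomorph_apply, hv] at h
  refine Eq.trans ?_ h
  exact congrArg (d% (fun y ↦ Ω₁.toFun y (Y y) (Z y)) (σ x)) (hv (X (σ x))).symm

/-- The difference of two torsion-free connections preserving `ω` is totally symmetric. -/
lemma difference_symm {D D' : LinConnection E M} (hD : D.torsion = 0) (hD' : D'.torsion = 0)
    {x : M} (X Y : TangentSpace 𝓘(ℝ, E) x) :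
    D.difference D' x X Y = D.difference D' x Y X := by
  have hd : ∀ X, D.difference D' x X = D (FiberBundle.extend E X) x - D' (FiberBundle.extend E X) x := by
    intro X
    have := IsCovariantDerivativeOn.difference_apply D.isCovariantDerivativeOnUniv
      D'.isCovariantDerivativeOnUniv (Set.mem_univ x)
      (FiberBundle.mdifferentiableAt_extend 𝓘(ℝ, E) E X)
    rwa [FiberBundle.extend_apply_self] at this
  rw [CovariantDerivative.torsion_eq_zero_iff] at hD hD'
  have h1 := hD (FiberBundle.mdifferentiableAt_extend 𝓘(ℝ, E) E X)
    (FiberBundle.mdifferentiableAt_extend 𝓘(ℝ, E) E Y)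
  have h2 := hD' (FiberBundle.mdifferentiableAt_extend 𝓘(ℝ, E) E X)
    (FiberBundle.mdifferentiableAt_extend 𝓘(ℝ, E) E Y)
  rw [← h2] at h1
  simp only [FiberBundle.extend_apply_self] at h1
  rw [hd, hd, sub_apply, sub_apply]
  rw [sub_eq_sub_iff_add_eq_add] at h1 ⊢
  rw [add_comm, ← h1, add_comm]

/-- Each S_X lies in the symplectic Lie algebra: subtracting the two Leibniz rules for ω removes the
derivative of ω(Y, Z). The direction X is the last argument of `difference`. -/
lemma difference_skew [T2Space M] {Ω : SymplecticForm E M} {D D' : LinConnection E M}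
    (hD : ∀ X Y Z : (∀ x : M, TangentSpace 𝓘(ℝ, E) x),
      CMDiff ∞ (T% X) → CMDiff ∞ (T% Y) → CMDiff ∞ (T% Z) → ∀ x,
      d% (fun y ↦ Ω.toFun y (Y y) (Z y)) x (X x) =
        Ω.toFun x (D Y x (X x)) (Z x) + Ω.toFun x (Y x) (D Z x (X x)))
    (hD' : ∀ X Y Z : (∀ x : M, TangentSpace 𝓘(ℝ, E) x),
      CMDiff ∞ (T% X) → CMDiff ∞ (T% Y) → CMDiff ∞ (T% Z) → ∀ x,
      d% (fun y ↦ Ω.toFun y (Y y) (Z y)) x (X x) =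
        Ω.toFun x (D' Y x (X x)) (Z x) + Ω.toFun x (Y x) (D' Z x (X x)))
    {x : M} (X Y Z : TangentSpace 𝓘(ℝ, E) x) :
    Ω.toFun x (D.difference D' x Y X) Z + Ω.toFun x Y (D.difference D' x Z X) = 0 := by
  -- The parallelism hypotheses concern globally smooth fields, so the vectors are extended to such
  -- fields.
  obtain ⟨X, hX, rfl⟩ := exists_contMDiff_vectorField X
  obtain ⟨Y, hY, rfl⟩ := exists_contMDiff_vectorField Y
  obtain ⟨Z, hZ, rfl⟩ := exists_contMDiff_vectorField Z
  have hd : ∀ {Y : ∀ x : M, TangentSpace 𝓘(ℝ, E) x}, CMDiff ∞ (T% Y) →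
      D.difference D' x (Y x) = D Y x - D' Y x := fun hY ↦
    IsCovariantDerivativeOn.difference_apply D.isCovariantDerivativeOnUniv
      D'.isCovariantDerivativeOnUniv (Set.mem_univ x) ((hY x).mdifferentiableAt (by simp))
  have h1 := hD X Y Z hX hY hZ x
  have h2 := hD' X Y Z hX hY hZ x
  simp only [hd hY, hd hZ, sub_apply, map_sub]
  linarith

end

/-! ### Square roots near the identity -/

section SquareRoot

/-- A smooth local square root near `1` in a Banach algebra. -/
lemma exists_contDiffAt_sqrt (A : Type*) [NormedRing A] [NormedAlgebra ℝ A] [CompleteSpace A] :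
    ∃ s : A → A, ContDiffAt ℝ ∞ s 1 ∧ s 1 = 1 ∧ (∀ᶠ a in 𝓝 1, s a * s a = a) ∧
      ∀ᶠ a in 𝓝 1, s (a * a) = a := by
  let L : A ≃L[ℝ] A := ContinuousLinearEquiv.equivOfInverse
    ((2 : ℝ) • ContinuousLinearMap.id ℝ A) ((2⁻¹ : ℝ) • ContinuousLinearMap.id ℝ A)
    (fun x ↦ by simp) (fun x ↦ by simp)
  -- The derivative of squaring at 1 is 2·id, so the inverse function theorem applies. Its
  -- left-inverse half gives uniqueness of the root near 1.
  have hf : HasStrictFDerivAt (fun a : A ↦ a * a) (L : A →L[ℝ] A) 1 := by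
    refine ((hasStrictFDerivAt_id (𝕜 := ℝ) (1 : A)).mul' (hasStrictFDerivAt_id 1)).congr_fderiv ?_
    ext x
    simp [L, two_smul]
  have hc : ContDiffAt ℝ ∞ (fun a : A ↦ a * a) 1 := contDiffAt_id.mul contDiffAt_id
  have h1 := hf.eventually_right_inverse
  rw [mul_one] at h1
  refine ⟨hf.localInverse _ _ _, ?_, ?_, h1, hf.eventually_left_inverse⟩
  · have := hc.to_localInverse hf.hasFDerivAt (by simp)
    rw [mul_one] at this
    exact this
  · have := hf.localInverse_apply_image
    rwa [mul_one] at this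

end SquareRoot

/-! ### Straightening a smooth family of symplectic forms -/

section Forms

variable {E : Type*} [NormedAddCommGroup E] [NormedSpace ℝ E] [FiniteDimensional ℝ E]

/-- A smooth family of alternating forms is locally obtained from its value at `0`, if that is
nondegenerate, by a smooth family of linear substitutions. -/
lemma exists_contDiffAt_pullback_eq {W : ℝ → E →L[ℝ] E →L[ℝ] ℝ} (hW : ContDiffAt ℝ ∞ W 0)
    (halt : ∀ᶠ t in 𝓝 0, ∀ v, W t v v = 0) (hnd : ∀ v, (∀ w, W 0 v w = 0) → v = 0) :
    ∃ g : ℝ → E →L[ℝ] E, ContDiffAt ℝ ∞ g 0 ∧ g 0 = 1 ∧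
      ∀ᶠ t in 𝓝 0, IsUnit (g t) ∧ ∀ v w, W t v w = W 0 (g t v) (g t w) := by
  have := FiniteDimensional.complete ℝ E
  have hneg : ∀ {t}, (∀ v, W t v v = 0) → ∀ v w, W t v w = -W t w v := fun {t} h v w ↦ by
    have := h (v + w)
    simp [h] at this
    linarith
  have h0 := hneg halt.self_of_nhds
  let e : E →ₗ[ℝ] (E →L[ℝ] ℝ) := W 0
  have hinj : Function.Injective e :=
    (injective_iff_map_eq_zero _).2 fun v hv ↦ hnd v fun w ↦ congr($hv w)
  have hfr : Module.finrank ℝ E = Module.finrank ℝ (E →L[ℝ] ℝ) := by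
    rw [← (LinearMap.toContinuousLinearMap (𝕜 := ℝ) (E := E) (F' := ℝ)).finrank_eq]
    exact (Subspace.dual_finrank_eq (K := ℝ) (V := E)).symm
  let φ : E ≃L[ℝ] (E →L[ℝ] ℝ) :=
    (LinearEquiv.ofInjectiveOfFinrankEq e hinj hfr).toContinuousLinearEquiv
  have hφ : ∀ v w, W 0 v w = φ v w := fun v w ↦ rfl
  -- Writing W_t = W₀(B_t ·, ·), the required substitution is the square root g_t of B_t: if g_t is
  -- W₀-self-adjoint, then W₀(g_t²v, w) = W₀(g_t v, g_t w).
  let B : ℝ → E →L[ℝ] E := fun t ↦ (φ.symm : (E →L[ℝ] ℝ) →L[ℝ] E) ∘L W t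
  have hB : ∀ t v w, W 0 (B t v) w = W t v w := fun t v w ↦ by
    rw [hφ]
    change φ (φ.symm (W t v)) w = _
    rw [φ.apply_symm_apply]
  have hext : ∀ {x y}, (∀ w, W 0 x w = W 0 y w) → x = y := fun {x y} h ↦
    φ.injective (ContinuousLinearMap.ext h)
  have hB0 : B 0 = 1 := ContinuousLinearMap.ext fun v ↦ hext fun w ↦ hB 0 v w
  have hBs : ContDiffAt ℝ ∞ B 0 := contDiffAt_const.clm_comp hW
  -- the adjoint with respect to `W 0`
  let ad : (E →L[ℝ] E) →L[ℝ] (E →L[ℝ] E) :=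
    ContinuousLinearMap.compL ℝ E (E →L[ℝ] ℝ) E (φ.symm : (E →L[ℝ] ℝ) →L[ℝ] E) ∘L
      (ContinuousLinearMap.compL ℝ E (E →L[ℝ] ℝ) (E →L[ℝ] ℝ)).flip (φ : E →L[ℝ] (E →L[ℝ] ℝ)) ∘L
      (ContinuousLinearMap.compL ℝ E E ℝ).flip
  have had : ∀ a v w, W 0 (ad a v) w = W 0 v (a w) := fun a v w ↦ by
    rw [hφ, hφ]
    change φ (φ.symm (φ v ∘L a)) w = _
    rw [φ.apply_symm_apply]
    rfl
  have had1 : ad 1 = 1 := ContinuousLinearMap.ext fun v ↦ hext fun w ↦ had 1 v w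
  have hadm : ∀ a, ad (a * a) = ad a * ad a := fun a ↦
    ContinuousLinearMap.ext fun v ↦ hext fun w ↦ by
      rw [had, mul_apply_eq_comp, mul_apply_eq_comp, had, had]
  obtain ⟨s, hs, hs1, hsq, hsq'⟩ := exists_contDiffAt_sqrt (E →L[ℝ] E)
  have hBt : Filter.Tendsto B (𝓝 0) (𝓝 1) := hB0 ▸ hBs.continuousAt
  have hg : ContDiffAt ℝ ∞ (fun t ↦ s (B t)) 0 :=
    ContDiffAt.comp (g := s) 0 (by rwa [hB0]) hBs
  have hg0 : s (B 0) = 1 := by rw [hB0, hs1]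
  have hgt : Filter.Tendsto (fun t ↦ s (B t)) (𝓝 0) (𝓝 1) := by
    have := hg.continuousAt.tendsto
    rwa [hg0] at this
  have hadt : Filter.Tendsto (fun t ↦ ad (s (B t))) (𝓝 0) (𝓝 1) := by
    have := (ad.continuous.tendsto 1).comp hgt
    rwa [had1] at this
  refine ⟨fun t ↦ s (B t), hg, hg0, ?_⟩
  filter_upwards [halt, hBt.eventually hsq, hgt.eventually hsq', hadt.eventually hsq',
    hgt.eventually (Units.isOpen.mem_nhds isUnit_one)] with t h1 h2 h3 h4 h5
  refine ⟨h5, fun v w ↦ ?_⟩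
  -- Self-adjointness of B_t holds because W₀ and W_t are both alternating.
  have hadB : ad (B t) = B t := ContinuousLinearMap.ext fun v ↦ hext fun w ↦ by
    rw [had, hB, h0, hB, ← hneg h1]
  -- The adjoint of g_t is also a square root of B_t close to 1, so it equals g_t by uniqueness.
  have hself : ad (s (B t)) = s (B t) := by
    rw [← h4, ← hadm, h2, hadB]
  rw [← had, hself, ← mul_apply_eq_comp, h2, hB]

end Forms

/-! ### The twistor projection is a submersion -/

section

variable {E : Type*} [NormedAddCommGroup E] [NormedSpace ℝ E] [FiniteDimensional ℝ E]
  {M : Type*} [TopologicalSpace M] [ChartedSpace E M] [IsManifold 𝓘(ℝ, E) ∞ M]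

lemma isTwistor_iff {Ω : SymplecticForm E M} {l : ℕ} {j : EndT E M} :
    IsTwistor (Ω.toFun j.proj) l j.snd ↔ j ∈ TwistorSpace Ω l :=
  ⟨fun h ↦ ⟨h.sq, h.compat, h.sigPos, h.sigNeg⟩, fun h ↦ ⟨h.1, h.2.1, h.2.2.1, h.2.2.2⟩⟩

lemma SymplecticForm.exists_contDiffAt_coord (Ω : SymplecticForm E M) {γ : ℝ → M}
    (hγ : ContMDiffAt 𝓘(ℝ, ℝ) 𝓘(ℝ, E) ∞ γ 0) :
    ∃ W : ℝ → E →L[ℝ] E →L[ℝ] ℝ, ContDiffAt ℝ ∞ W 0 ∧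
      ∀ t, γ t ∈ (trivializationAt E (TangentSpace 𝓘(ℝ, E)) (γ 0)).baseSet → ∀ v w,
        W t v w = Ω.toFun (γ t)
          ((trivializationAt E (TangentSpace 𝓘(ℝ, E)) (γ 0)).symm (γ t) v)
          ((trivializationAt E (TangentSpace 𝓘(ℝ, E)) (γ 0)).symm (γ t) w) := by
  have h := (Ω.smooth (γ 0)).comp 0 hγ
  have h2 := ((contMDiffAt_hom_bundle _).1 h).2
  refine ⟨_, h2.contDiffAt, fun t ht v w ↦ ?_⟩
  refine (inCoordinates_apply_eq₂ (𝕜 := ℝ) (F₃ := ℝ) (E₃ := Bundle.Trivial M ℝ) ht ht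
    (Set.mem_univ _)).trans ?_
  have : (trivializationAt ℝ (Bundle.Trivial M ℝ) (γ 0)).linearMapAt ℝ (γ t) = LinearMap.id :=
    Bundle.Trivial.linearMapAt_trivialization ℝ M ℝ (γ t)
  exact congr($this _)

/-- Every curve in `M` lifts to `𝒵^l` with a prescribed initial value. -/
lemma exists_lift_twistorSpace (Ω : SymplecticForm E M) {l : ℕ} {γ : ℝ → M}
    (hγ : ContMDiffAt 𝓘(ℝ, ℝ) 𝓘(ℝ, E) ∞ γ 0)
    {A : TangentSpace 𝓘(ℝ, E) (γ 0) →L[ℝ] TangentSpace 𝓘(ℝ, E) (γ 0)}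
    (hA : (⟨γ 0, A⟩ : EndT E M) ∈ TwistorSpace Ω l) :
    ∃ c : ℝ → EndT E M, ContMDiffAt 𝓘(ℝ, ℝ) (endModel E) ∞ c 0 ∧
      (∀ᶠ t in 𝓝 0, c t ∈ TwistorSpace Ω l) ∧ (∀ t, (c t).proj = γ t) ∧ c 0 = ⟨γ 0, A⟩ := by
  have := FiniteDimensional.complete ℝ E
  set e := trivializationAt E (TangentSpace 𝓘(ℝ, E) : M → Type _) (γ 0)
  have h0 : γ 0 ∈ e.baseSet := FiberBundle.mem_baseSet_trivializationAt' (γ 0)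
  have hmem : ∀ᶠ t in 𝓝 0, γ t ∈ e.baseSet :=
    hγ.continuousAt.eventually (e.open_baseSet.mem_nhds h0)
  obtain ⟨W, hW, hWe⟩ := Ω.exists_contDiffAt_coord hγ
  have hWs : ∀ {t} (ht : γ t ∈ e.baseSet) v w, W t v w =
      Ω.toFun (γ t) ((e.continuousLinearEquivAt ℝ (γ t) ht).symm v)
        ((e.continuousLinearEquivAt ℝ (γ t) ht).symm w) := fun {t} ht v w ↦ by
    rw [hWe t ht]
    rfl
  obtain ⟨g, hg, hg0, hgW⟩ := exists_contDiffAt_pullback_eq hW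
    (hmem.mono fun t ht v ↦ by rw [hWs ht]; exact Ω.alternating _ _)
    (fun v hv ↦ by
      have : (e.continuousLinearEquivAt ℝ (γ 0) h0).symm v = 0 := by
        refine Ω.nondegenerate _ _ fun w ↦ ?_
        have := hv (e.continuousLinearEquivAt ℝ (γ 0) h0 w)
        rwa [hWs h0, ContinuousLinearEquiv.symm_apply_apply] at this
      exact (e.continuousLinearEquivAt ℝ (γ 0) h0).symm.map_eq_zero_iff.1 this)
  let J : E →L[ℝ] E := e.continuousLinearMapAt ℝ (γ 0) ∘L A ∘L e.symmL ℝ (γ 0)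
  have hJ : IsTwistor (W 0) l J := by
    have := (isTwistor_iff.2 hA).conj (θ' := W 0) (e.continuousLinearEquivAt ℝ (γ 0) h0)
      (fun x y ↦ by
        rw [hWs h0, ContinuousLinearEquiv.symm_apply_apply, ContinuousLinearEquiv.symm_apply_apply])
    rwa [Trivialization.coe_continuousLinearEquivAt_eq',
      Trivialization.symm_continuousLinearEquivAt_eq'] at this
  -- Since W_t is the pull-back of W₀ by g_t, conjugating the fixed structure J by g_t⁻¹ yields
  -- structures compatible with W_t, of the same signature.
  let K : ℝ → E →L[ℝ] E := fun t ↦ Ring.inverse (g t) * (J * g t)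
  have hK : ContDiffAt ℝ ∞ K 0 := by
    refine ContDiffAt.mul ?_ (contDiffAt_const.mul hg)
    refine ContDiffAt.comp (g := Ring.inverse) 0 ?_ hg
    rw [hg0]
    exact contDiffAt_ringInverse ℝ (1 : (E →L[ℝ] E)ˣ)
  let c : ℝ → EndT E M := fun t ↦
    ⟨γ t, e.symmL ℝ (γ t) ∘L K t ∘L e.continuousLinearMapAt ℝ (γ t)⟩
  refine ⟨c, ?_, ?_, fun t ↦ rfl, ?_⟩
  · refine (contMDiffAt_hom_bundle c).2 ⟨hγ, ?_⟩
    refine ContMDiffAt.congr_of_eventuallyEq hK.contMDiffAt ?_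
    filter_upwards [hmem] with t ht
    ext v
    have h1 : ∀ v, e.continuousLinearMapAt ℝ (γ t) (e.symmL ℝ (γ t) v) = v :=
      fun v ↦ e.continuousLinearMapAt_symmL ht v
    change e.continuousLinearMapAt ℝ (γ t) (e.symmL ℝ (γ t) (K t
      (e.continuousLinearMapAt ℝ (γ t) (e.symmL ℝ (γ t) v)))) = K t v
    rw [h1, h1]
  · filter_upwards [hmem, hgW] with t ht ⟨⟨u, hu⟩, hgt⟩
    let G : E ≃L[ℝ] TangentSpace 𝓘(ℝ, E) (γ t) :=
      (ContinuousLinearEquiv.unitsEquiv ℝ E u⁻¹).trans (e.continuousLinearEquivAt ℝ (γ t) ht).symm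
    have hug : ∀ x, g t (((u⁻¹ : (E →L[ℝ] E)ˣ) : E →L[ℝ] E) x) = x := fun x ↦ by
      rw [← hu, ← mul_apply_eq_comp, Units.mul_inv]
      rfl
    have := hJ.conj (θ' := Ω.toFun (γ t)) G (fun x y ↦ by
      refine (hWs ht _ _).symm.trans ?_
      rw [hgt]
      exact congrArg₂ (fun x y ↦ W 0 x y) (hug x) (hug y))
    refine isTwistor_iff.1 ?_
    convert this using 1
    have hinv : Ring.inverse (g t) = (u⁻¹ : (E →L[ℝ] E)ˣ) := by rw [← hu, Ring.inverse_unit]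
    refine ContinuousLinearMap.ext fun v ↦ ?_
    change e.symmL ℝ (γ t) (Ring.inverse (g t) (J (g t (e.continuousLinearMapAt ℝ (γ t) v)))) = _
    rw [hinv, ← hu, ← Trivialization.coe_continuousLinearEquivAt_eq e ht,
      ← Trivialization.symm_continuousLinearEquivAt_eq e ht]
    rfl
  · refine congrArg (TotalSpace.mk (γ 0)) (ContinuousLinearMap.ext fun v ↦ ?_)
    have h1 : ∀ v, e.symmL ℝ (γ 0) (e.continuousLinearMapAt ℝ (γ 0) v) = v :=
      fun v ↦ e.symmL_continuousLinearMapAt h0 v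
    change e.symmL ℝ (γ 0) (Ring.inverse (g 0) (e.continuousLinearMapAt ℝ (γ 0)
      (A (e.symmL ℝ (γ 0) (g 0 (e.continuousLinearMapAt ℝ (γ 0) v)))))) = A v
    rw [hg0, Ring.inverse_one]
    change e.symmL ℝ (γ 0) (e.continuousLinearMapAt ℝ (γ 0)
      (A (e.symmL ℝ (γ 0) (e.continuousLinearMapAt ℝ (γ 0) v)))) = A v
    rw [h1, h1]

/-- Every tangent vector of `M` is the velocity of a smooth curve. -/
lemma exists_curve_hasMFDerivAt (x : M) (X : E) :
    ∃ γ : ℝ → M, ContMDiffAt 𝓘(ℝ, ℝ) 𝓘(ℝ, E) ∞ γ 0 ∧ γ 0 = x ∧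
      HasMFDerivAt 𝓘(ℝ, ℝ) 𝓘(ℝ, E) γ 0 (ContinuousLinearMap.toSpanSingleton ℝ X) := by
  let p : ℝ → E := fun t ↦ extChartAt 𝓘(ℝ, E) x x + t • X
  have hp : ContDiff ℝ ∞ p := contDiff_const.add (contDiff_id.smul contDiff_const)
  have hp0 : p 0 = extChartAt 𝓘(ℝ, E) x x := by simp [p]
  have hp' : HasFDerivAt p (ContinuousLinearMap.toSpanSingleton ℝ X) 0 := by
    have : HasDerivAt p X 0 := by
      have h := ((hasDerivAt_id (0 : ℝ)).smul_const X).const_add (extChartAt 𝓘(ℝ, E) x x)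
      rwa [one_smul] at h
    exact this.hasFDerivAt
  let γ : ℝ → M := fun t ↦ (extChartAt 𝓘(ℝ, E) x).symm (p t)
  have hγ0 : γ 0 = x := by simp [γ, hp0]
  have hγ : ContMDiffAt 𝓘(ℝ, ℝ) 𝓘(ℝ, E) ∞ γ 0 := by
    refine ContMDiffAt.comp (g := (extChartAt 𝓘(ℝ, E) x).symm) 0 ?_ hp.contDiffAt.contMDiffAt
    refine (contMDiffOn_extChartAt_symm x).contMDiffAt ?_
    rw [hp0]
    exact extChartAt_target_mem_nhds x
  refine ⟨γ, hγ, hγ0, hγ.continuousAt, ?_⟩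
  refine HasFDerivAt.hasFDerivWithinAt (F := E) ?_
  refine hp'.congr_of_eventuallyEq ?_
  have : ∀ᶠ t in 𝓝 0, p t ∈ (extChartAt 𝓘(ℝ, E) x).target :=
    hp.continuous.continuousAt.eventually (by rw [hp0]; exact extChartAt_target_mem_nhds x)
  filter_upwards [this] with t ht
  change extChartAt 𝓘(ℝ, E) (γ 0) (γ t) = p t
  rw [hγ0]
  exact (extChartAt 𝓘(ℝ, E) x).right_inv ht

/-- The projection `𝒵^l → M` is a submersion. -/
lemma exists_mem_twistorTangent (Ω : SymplecticForm E M) {l : ℕ} {j : EndT E M}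
    (hj : j ∈ TwistorSpace Ω l) (X : TangentSpace 𝓘(ℝ, E) j.proj) :
    ∃ v : TangentSpace (endModel E) j,
      (⟨j, v⟩ : TangentBundle (endModel E) (EndT E M)) ∈ twistorTangent Ω l ∧ baseDir v = X := by
  -- The velocity of the lifted curve lies over `c 0`, which equals `j` only propositionally; hence
  -- the detour through the total space.
  suffices h : ∃ u ∈ twistorTangent Ω l, u.proj = j ∧ (baseDir u.snd : E) = (X : E) by
    obtain ⟨⟨j, v⟩, hu, rfl, h⟩ := h
    exact ⟨v, hu, h⟩
  obtain ⟨x, A⟩ := j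
  obtain ⟨γ, hγ, rfl, hγ'⟩ := exists_curve_hasMFDerivAt (E := E) x X
  obtain ⟨c, hc, hcm, hcγ, hc0⟩ := exists_lift_twistorSpace Ω hγ hj
  refine ⟨_, ⟨c, hc, hcm, rfl⟩, hc0, ?_⟩
  have hd := (hasMFDerivAt_proj (c 0)).comp 0 (hc.mdifferentiableAt (by simp)).hasMFDerivAt
  have hcγ' : TotalSpace.proj ∘ c = γ := funext hcγ
  rw [hcγ'] at hd
  exact (baseDir_eq _).trans ((congr($(hasMFDerivAt_unique hd hγ') (1 : ℝ))).trans (one_smul ℝ (X : E)))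

end

/-! ### From holomorphy to the vanishing of the difference -/

section

variable {E : Type*} [NormedAddCommGroup E] [NormedSpace ℝ E] [FiniteDimensional ℝ E]
  {M : Type*} [TopologicalSpace M] [ChartedSpace E M] [IsManifold 𝓘(ℝ, E) ∞ M]
  {M₁ : Type*} [TopologicalSpace M₁] [ChartedSpace E M₁] [IsManifold 𝓘(ℝ, E) ∞ M₁]

lemma baseDir_horLift_add_vertLift (D : LinConnection E M) (j : EndT E M)
    (X : TangentSpace 𝓘(ℝ, E) j.proj)
    (A : TangentSpace 𝓘(ℝ, E) j.proj →L[ℝ] TangentSpace 𝓘(ℝ, E) j.proj) :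
    baseDir (horLift D j X + vertLift j A) = X :=
  (baseDir_eq _).trans (add_zero X)

/-- With a, b the Christoffel endomorphisms in the directions jX, X, and primes for the second
connection, `h` compares the vertical parts of the two twistor structures. The term J B occurs on
both sides and drops out, leaving [J, a - a'] = J[J, b - b']. -/
lemma commutator_identity {J a a' b b' B : E →L[ℝ] E} (hJ : ∀ X, J (J X) = -X)
    (h : J ∘L a' - a' ∘L J + J ∘L B =
      J ∘L a - a ∘L J + J ∘L (J ∘L b' - b' ∘L J + B - (J ∘L b - b ∘L J))) (Y : E) :
    (a - a') (J Y) - J ((a - a') Y) = J ((b - b') (J Y)) + (b - b') Y := by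
  have h1 := congr($h Y)
  simp only [ContinuousLinearMap.comp_apply, sub_apply, add_apply, map_sub, map_add, hJ] at h1 ⊢
  rw [← sub_eq_zero] at h1 ⊢
  rw [← h1]
  abel

lemma christoffel_sub_eq_difference (D D' : LinConnection E M) {x : M}
    (X Y : TangentSpace 𝓘(ℝ, E) x) :
    christoffel D x X Y - christoffel D' x X Y = D.difference D' x Y X := by
  have h := IsCovariantDerivativeOn.difference_apply D.isCovariantDerivativeOnUniv
    D'.isCovariantDerivativeOnUniv (Set.mem_univ x)
    (FiberBundle.mdifferentiableAt_extend 𝓘(ℝ, E) E Y)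
  rw [FiberBundle.extend_apply_self] at h
  exact congr($h X).symm

/-- The twistor almost complex structures of two connections agree at a vector over `X` only if
the difference tensor satisfies an algebraic identity. -/
lemma difference_identity {D D' : LinConnection E M} {j : EndT E M}
    (hj : ∀ X, j.snd (j.snd X) = -X) {Z : TangentSpace 𝓘(ℝ, E) j.proj}
    {B : TangentSpace 𝓘(ℝ, E) j.proj →L[ℝ] TangentSpace 𝓘(ℝ, E) j.proj}
    (h : horLift D' j (j.snd Z) + vertLift j (j.snd ∘L B) =
      (twistorJ D ⟨j, horLift D' j Z + vertLift j B⟩).snd) (Y : TangentSpace 𝓘(ℝ, E) j.proj) :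
    D.difference D' j.proj (j.snd Y) (j.snd Z) - j.snd (D.difference D' j.proj Y (j.snd Z)) =
      j.snd (D.difference D' j.proj (j.snd Y) Z) + D.difference D' j.proj Y Z := by
  simp only [twistorJ, nablaPhi, baseDir_horLift_add_vertLift] at h
  simp only [← christoffel_sub_eq_difference]
  exact commutator_identity (E := E) (J := j.snd) hj (congrArg Prod.snd h) Y

lemma mfderiv_twistorMap_add (σ : M ≃ₘ^∞⟮𝓘(ℝ, E), 𝓘(ℝ, E)⟯ M₁) (D : LinConnection E M)
    (j : EndT E M) (X : TangentSpace 𝓘(ℝ, E) j.proj)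
    (A : TangentSpace 𝓘(ℝ, E) j.proj →L[ℝ] TangentSpace 𝓘(ℝ, E) j.proj) :
    mfderiv (endModel E) (endModel E) (twistorMap σ) j (horLift D j X + vertLift j A) =
      horLift (pushConnection σ D) (twistorMap σ j) (dEquiv σ j.proj X) +
        vertLift (twistorMap σ j)
          ((dEquiv σ j.proj : _ →L[ℝ] TangentSpace 𝓘(ℝ, E) (σ j.proj)) ∘L A ∘L
          ((dEquiv σ j.proj).symm : TangentSpace 𝓘(ℝ, E) (σ j.proj) →L[ℝ] _)) :=
  (ContinuousLinearMap.map_add _ _ _).trans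
    (congrArg₂ _ (mfderiv_twistorMap_horLift σ D j X) (mfderiv_twistorMap_vertLift σ j A))

/-- Once dΣ is expressed through the lifts of σ·∇, holomorphy compares the twistor structures of ∇²
and σ·∇ on M₁. The separate variable `J` allows a structure that is equal to Σ(j) only
propositionally. -/
lemma IsHolomorphicTwistorMap.difference_identity {l : ℕ} {Ω : SymplecticForm E M}
    {Ω₁ : SymplecticForm E M₁} {σ : M ≃ₘ^∞⟮𝓘(ℝ, E), 𝓘(ℝ, E)⟯ M₁}
    (hσ : IsSymplectomorphism Ω Ω₁ σ) {D : LinConnection E M} {D₂ : LinConnection E M₁}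
    (hhol : IsHolomorphicTwistorMap σ Ω l D D₂) {j : EndT E M} (hj : j ∈ TwistorSpace Ω l)
    {J : TangentSpace 𝓘(ℝ, E) (σ j.proj) →L[ℝ] TangentSpace 𝓘(ℝ, E) (σ j.proj)}
    (hJ : (twistorMap σ j).snd = J) (Y Z : TangentSpace 𝓘(ℝ, E) (σ j.proj)) :
    D₂.difference (pushConnection σ D) (σ j.proj) (J Y) (J Z)
        - J (D₂.difference (pushConnection σ D) (σ j.proj) Y (J Z)) =
      J (D₂.difference (pushConnection σ D) (σ j.proj) (J Y) Z)
        + D₂.difference (pushConnection σ D) (σ j.proj) Y Z := by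
  subst hJ
  obtain ⟨v, hv, hX⟩ := exists_mem_twistorTangent Ω hj ((dEquiv σ j.proj).symm Z)
  let B : TangentSpace 𝓘(ℝ, E) (σ j.proj) →L[ℝ] TangentSpace 𝓘(ℝ, E) (σ j.proj) :=
    (dEquiv σ j.proj : _ →L[ℝ] TangentSpace 𝓘(ℝ, E) (σ j.proj)) ∘L nablaPhi D v ∘L
      ((dEquiv σ j.proj).symm : TangentSpace 𝓘(ℝ, E) (σ j.proj) →L[ℝ] _)
  have e1 : mfderiv (endModel E) (endModel E) (twistorMap σ) j v =
      horLift (pushConnection σ D) (twistorMap σ j) Z + vertLift (twistorMap σ j) B := by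
    refine (congrArg _ (eq_horLift_add_vertLift D v)).trans
      ((mfderiv_twistorMap_add σ D j _ _).trans (congrArg₂ _ (congrArg _ ?_) rfl))
    rw [hX]
    exact (dEquiv σ j.proj).apply_symm_apply Z
  have e2 : mfderiv (endModel E) (endModel E) (twistorMap σ) j (twistorJ D ⟨j, v⟩).snd =
      horLift (pushConnection σ D) (twistorMap σ j) ((twistorMap σ j).snd Z)
        + vertLift (twistorMap σ j) ((twistorMap σ j).snd ∘L B) := by
    refine (mfderiv_twistorMap_add σ D j _ _).trans
      (congrArg₂ _ (congrArg _ ?_) (congrArg _ (ContinuousLinearMap.ext fun w ↦ ?_)))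
    · exact congrArg (fun X ↦ dEquiv σ j.proj (j.snd X)) hX
    · exact congrArg (fun X ↦ dEquiv σ j.proj (j.snd X))
        ((dEquiv σ j.proj).symm_apply_apply (nablaPhi D v ((dEquiv σ j.proj).symm w))).symm
  have e3 : mfderiv (endModel E) (endModel E) (twistorMap σ) j (twistorJ D ⟨j, v⟩).snd =
      (twistorJ D₂ ⟨twistorMap σ j, mfderiv (endModel E) (endModel E) (twistorMap σ) j v⟩).snd :=
    TotalSpace.mk_injective (F := E × (E →L[ℝ] E)) (twistorMap σ j) (hhol _ hv)
  rw [e1, e2] at e3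
  exact SympTwistor.difference_identity (twistorMap_mem hσ hj).1 e3 Y

/-- Σ is onto the fibre over σ(x): any j there is the image of dσ⁻¹ ∘ j ∘ dσ. Hence the algebraic
identity holds for all j, as the vanishing theorem requires. -/
lemma difference_eq_zero_of_isHolomorphicTwistorMap [T2Space M₁] {n l : ℕ} (hl : l ≤ n)
    (hn : Module.finrank ℝ E = 2 * n) {Ω : SymplecticForm E M} {Ω₁ : SymplecticForm E M₁}
    {σ : M ≃ₘ^∞⟮𝓘(ℝ, E), 𝓘(ℝ, E)⟯ M₁} (hσ : IsSymplectomorphism Ω Ω₁ σ)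
    {D : LinConnection E M} (hD : IsSymplecticConnection Ω D)
    {D₂ : LinConnection E M₁} (hD₂ : IsSymplecticConnection Ω₁ D₂)
    (hhol : IsHolomorphicTwistorMap σ Ω l D D₂) (x : M) :
    D₂.difference (pushConnection σ D) (σ x) = 0 := by
  have : FiniteDimensional ℝ (TangentSpace 𝓘(ℝ, E) (σ x)) := inferInstanceAs (FiniteDimensional ℝ E)
  have : T2Space (TangentSpace 𝓘(ℝ, E) (σ x)) := inferInstanceAs (T2Space E)
  have hs := fun X Y : TangentSpace 𝓘(ℝ, E) (σ x) ↦
    difference_symm hD₂.torsion_free (pushConnection_torsion σ hD.torsion_free) X Y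
  refine eq_zero_of_forall_isTwistor (θ := Ω₁.toFun (σ x)) (Ω₁.alternating _)
    (Ω₁.nondegenerate _) hn hl hs (fun X Y Z ↦ ?_) fun j hj X Y ↦ ?_
  · have h := difference_skew hD₂.parallel (pushConnection_parallel σ hσ hD) X Y Z
    rw [hs X Y, hs X Z, eq_neg_of_add_eq_zero_left h]
    exact (LinearMap.IsAlt.neg (B := (Ω₁.toFun (σ x)).toLinearMap₁₂) (Ω₁.alternating (σ x)) _ _)
  · let A : TangentSpace 𝓘(ℝ, E) x →L[ℝ] TangentSpace 𝓘(ℝ, E) x :=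
      ((dEquiv σ x).symm : TangentSpace 𝓘(ℝ, E) (σ x) →L[ℝ] TangentSpace 𝓘(ℝ, E) x) ∘L j ∘L
        (dEquiv σ x : TangentSpace 𝓘(ℝ, E) x →L[ℝ] TangentSpace 𝓘(ℝ, E) (σ x))
    have hA : IsTwistor (Ω.toFun x) l A :=
      hj.conj (dEquiv σ x).symm fun X Y ↦ by
        rw [← hσ, ContinuousLinearEquiv.apply_symm_apply, ContinuousLinearEquiv.apply_symm_apply]
    -- The direction is the last argument of `difference` but the first in the algebraic theorem;
    -- symmetry exchanges them.
    rw [hs (j X) (j Y), hs (j X) Y, hs X (j Y), hs X Y]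
    refine hhol.difference_identity hσ (j := ⟨x, A⟩) (isTwistor_iff.1 hA) ?_ Y X
    refine ContinuousLinearMap.ext fun (v : TangentSpace 𝓘(ℝ, E) (σ x)) ↦ ?_
    change dEquiv σ x ((dEquiv σ x).symm (j (dEquiv σ x ((dEquiv σ x).symm v)))) = j v
    rw [ContinuousLinearEquiv.apply_symm_apply, ContinuousLinearEquiv.apply_symm_apply]

end

end SympTwistor

end

theorem corollary4p1 (n l : ℕ) (hl : l ≤ n)
    {M : Type*} [TopologicalSpace M] [T2Space M] [ParacompactSpace M]
    [ChartedSpace (EuclideanSpace ℝ (Fin (2 * n))) M] [IsManifold (𝓡 (2 * n)) ∞ M]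
    {M₁ : Type*} [TopologicalSpace M₁] [T2Space M₁] [ParacompactSpace M₁]
    [ChartedSpace (EuclideanSpace ℝ (Fin (2 * n))) M₁] [IsManifold (𝓡 (2 * n)) ∞ M₁]
    (Ω : SympTwistor.SymplecticForm (EuclideanSpace ℝ (Fin (2 * n))) M)
    (Ω₁ : SympTwistor.SymplecticForm (EuclideanSpace ℝ (Fin (2 * n))) M₁)
    (σ : M ≃ₘ^∞⟮𝓡 (2 * n), 𝓡 (2 * n)⟯ M₁)
    (hσ : SympTwistor.IsSymplectomorphism Ω Ω₁ σ)
    (D : SympTwistor.LinConnection (EuclideanSpace ℝ (Fin (2 * n))) M)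
    (hD : SympTwistor.IsSymplecticConnection Ω D)
    (D₂ : SympTwistor.LinConnection (EuclideanSpace ℝ (Fin (2 * n))) M₁)
    (hD₂ : SympTwistor.IsSymplecticConnection Ω₁ D₂)
    (hhol : SympTwistor.IsHolomorphicTwistorMap σ Ω l D D₂) :
    SympTwistor.SameConnection D₂ (SympTwistor.pushConnection σ D) ∧
      SympTwistor.InAffineOrbit Ω Ω₁ D D₂ := by
  have h : SympTwistor.SameConnection D₂ (SympTwistor.pushConnection σ D) := by
    intro Y y hY
    have hy : D₂.difference (SympTwistor.pushConnection σ D) y = 0 := by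
      obtain ⟨x, rfl⟩ : ∃ x, σ x = y := σ.surjective y
      exact SympTwistor.difference_eq_zero_of_isHolomorphicTwistorMap hl (by simp) hσ hD hD₂ hhol x
    -- The difference tensor computes D₂Y - (σ·D)Y at points where Y is differentiable.
    have hd := IsCovariantDerivativeOn.difference_apply D₂.isCovariantDerivativeOnUniv
      (SympTwistor.pushConnection σ D).isCovariantDerivativeOnUniv (Set.mem_univ y) hY
    exact sub_eq_zero.1 (hd.symm.trans congr($hy (Y y)))
  exact ⟨h, σ, hσ, h⟩
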